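/- **Setting.** Let $\mathcal A$ be the category of complex algebraic manifolds (smooth separated complex algebraic varieties of finite type) and regular maps. Let $\widetilde{\mathcal A}$ be the category whose objects are universal coverings $\widetilde X\to X$ of objects $X$ of $\mathcal A$ (for the classical topology; a covering whose restriction to each connected component of $X$ is simply connected, so $\widetilde X=\emptyset$ if $X=\emptyset$), and whose morphisms are commutative squares $$\begin{array}{ccc}\widetilde X&\to&\widetilde Y\\ \downarrow&&\downarrow\\ X&\to&Y\end{array}$$ with continuous top arrow and bottom arrow a morphism of $\mathcal A$. For $r\le s$, an $(r,s)$ truncated simplicial object of a category is a contravariant functor to it from the category of the ordinals $[n]=\{0,\dots,n\}$, $r\le n\le s$, and strictly order preserving maps. Fix $p\ge 1$. For $q\ge 0$ let $G^p_q$ be the generic part of the Grassmannian of $q$-planes in $\mathbb P^{p+q}(\mathbb C)$, i.e. the variety of $(p+q+1)$-tuples $(v_0,\dots,v_{p+q})$ of vectors of $\mathbb C^p$, any $p$ of which are linearly independent, modulo the diagonal action of $GL_p(\mathbb C)$. The $G^p_q$ with $0\le q\le p$, placed in degree $p+q$, form a $(p,2p)$ truncated simplicial variety $G^p_\bullet$: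 a strictly order preserving $f:[m]\to[n]$ acts by $(v_0,\dots,v_n)\mapsto(v_{f(0)},\dots,v_{f(m)})$, so that the $i$th face map omits the $i$th vector. **Constructible topology.** The completion of a set of linear subspaces of $\mathbb P^{p-1}$ is the set of all non-empty intersections of its members. For a configuration $x=(x_0,\dots,x_n)$ of points of $\mathbb P^{p-1}$ let $\mathcal D(x)$ be the smallest set of linear configurations that contains the completion of the set of hyperplanes spanned by subconfigurations of $x$, and that contains the completion of $\mathcal H\cup\{L*\operatorname{span}\mathcal X\}$ whenever $\mathcal H\in\mathcal D(x)$, $L\in\mathcal H$, $\mathcal X$ is a subconfiguration of $x$ and the join $L*\operatorname{span}\mathcal X$ is a hyperplane. An $n$-marked template is an isomorphism class of triples $(P,r,\psi)$, where $P$ is a partially ordered set, $r:P\to\mathbb N$ is order preserving and $\psi:[n]\to r^{-1}(0)$ is a function. Each $\mathcal H\in\mathcal D(x)$ (ordered by inclusion, with $r=\dim$ and $\psi(j)=x_j$) has a template; let $\mathcal T(x)$ be the set of these templates. For a $(p+q)$-marked template $T$ let $E^p_q(T)$ be the Zariski closure in $G^p_q$ of the set of orbits of tuples $(v_j)$ with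 $T\in\mathcal T([v_0],\dots,[v_{p+q}])$. The constructible topology on $G^p_q$ is the coarsest topology in which all the sets $E^p_q(T)$ are closed. A constructible open subset $U^p_\bullet$ of $G^p_\bullet$ is a family of subsets $U^p_q\subseteq G^p_q$, $0\le q\le p$, open in the constructible topology and preserved by all the simplicial structure maps; it is a truncated simplicial object of $\mathcal A$. **Theorem 7.2.** Every constructible open subset $U^p_\bullet$ of $G^p_\bullet$ lifts to a $(p,2p)$ truncated simplicial object $\widetilde U^p_\bullet$ of $\widetilde{\mathcal A}$, naturally with respect to inclusions. That is, one can choose a lift $\widetilde U^p_\bullet$ of every $U^p_\bullet$ (including $G^p_\bullet$ itself) and, for every inclusion $j:V^p_\bullet\hookrightarrow U^p_\bullet$ of constructible open subsets of $G^p_\bullet$, a lift $\tilde\jmath:\widetilde V^p_\bullet\to\widetilde U^p_\bullet$ of $j$ to a morphism of truncated simplicial objects of $\widetilde{\mathcal A}$, such that identities lift to identities and $\tilde\imath\,\tilde\jmath=\widetilde{\imath\jmath}$ for composable inclusions $i,j$. In other words, the functor $U^p_\bullet\mapsto U^p_\bullet$ from the ordered set of constructible open subsets of $G^p_\bullet$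 to truncated simplicial objects of $\mathcal A$ lifts to a functor to truncated simplicial objects of $\widetilde{\mathcal A}$. -/

import Mathlib

open CategoryTheory Topology

/-! # Complex algebraic manifolds, as spaces with functions -/

/-- A space with functions: a set with a (Zariski) topology and a sheaf of complex valued functions,
the sheaf being given by the predicate "`f` is regular at (i.e. on a neighbourhood of) `x`". -/
structure SpaceWithFunctions where
  carrier : Type
  [zariski : TopologicalSpace carrier]
  RegularAt : (carrier → ℂ) → carrier → Prop
  congr : ∀ {f g : carrier → ℂ} {x : carrier}, f =ᶠ[𝓝 x] g → RegularAt f x → RegularAt g x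
  eventually : ∀ {f : carrier → ℂ} {x : carrier}, RegularAt f x → ∀ᶠ y in 𝓝 x, RegularAt f y

namespace SpaceWithFunctions

instance (X : SpaceWithFunctions) : TopologicalSpace X.carrier := X.zariski

/-- Morphisms: continuous maps that pull regular functions back to regular functions. -/
@[ext] structure Hom (X Y : SpaceWithFunctions) where
  toFun : X.carrier → Y.carrier
  continuous : Continuous toFun
  regular : ∀ (f : Y.carrier → ℂ) (x : X.carrier),
    Y.RegularAt f (toFun x) → X.RegularAt (f ∘ toFun) x

instance : Category SpaceWithFunctions where
  Hom := Hom
  id X := ⟨id, continuous_id, fun _ _ h => h⟩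
  comp φ ψ := ⟨ψ.toFun ∘ φ.toFun, ψ.continuous.comp φ.continuous,
    fun f x h => φ.regular _ x (ψ.regular f _ h)⟩

@[simp] lemma comp_toFun {X Y Z : SpaceWithFunctions} (φ : X ⟶ Y) (ψ : Y ⟶ Z) :
    (φ ≫ ψ).toFun = ψ.toFun ∘ φ.toFun := rfl

@[simp] lemma id_toFun (X : SpaceWithFunctions) : (𝟙 X : X ⟶ X).toFun = id := rfl

lemma hom_ext {X Y : SpaceWithFunctions} {φ ψ : X ⟶ Y} (h : φ.toFun = ψ.toFun) : φ = ψ :=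
  Hom.ext h

/-- The structure induced on a subset: subspace topology, and the functions that locally extend
to regular functions of the ambient space. -/
def sub (X : SpaceWithFunctions) (S : Set X.carrier) : SpaceWithFunctions where
  carrier := S
  RegularAt f x := ∃ F : X.carrier → ℂ, X.RegularAt F x ∧ f =ᶠ[𝓝 x] F ∘ Subtype.val
  congr := by
    rintro f g x h ⟨F, hF, hf⟩
    exact ⟨F, hF, h.symm.trans hf⟩
  eventually := by
    rintro f x ⟨F, hF, hf⟩
    have h1 : ∀ᶠ y : S in 𝓝 x, X.RegularAt F y :=
      (continuous_subtype_val.tendsto x).eventually (X.eventually hF)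
    filter_upwards [h1, hf.eventually_nhds] with y hy hy'
    exact ⟨F, hy, hy'⟩

/-- The inclusion of a subset. -/
def incl (X : SpaceWithFunctions) (S : Set X.carrier) : X.sub S ⟶ X where
  toFun := Subtype.val
  continuous := continuous_subtype_val
  regular f _ h := ⟨f, h, Filter.EventuallyEq.rfl⟩

/-- A morphism with values in a subset. -/
def codRestrict {X Y : SpaceWithFunctions} (φ : X ⟶ Y) (T : Set Y.carrier)
    (h : ∀ x, φ.toFun x ∈ T) : X ⟶ Y.sub T where
  toFun x := ⟨φ.toFun x, h x⟩
  continuous := φ.continuous.subtype_mk h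
  regular := by
    rintro f x ⟨F, hF, hf⟩
    refine X.congr ?_ (φ.regular F x hF)
    have hc : Continuous fun x => (⟨φ.toFun x, h x⟩ : T) := φ.continuous.subtype_mk h
    exact ((hc.tendsto x).eventually hf).mono fun y hy => hy.symm

/-- The quotient by an equivalence relation: quotient topology, and the functions whose pullback
is regular. -/
def quot (X : SpaceWithFunctions) (s : Setoid X.carrier) : SpaceWithFunctions where
  carrier := Quotient s
  RegularAt f q := ∃ U : Set (Quotient s), IsOpen U ∧ q ∈ U ∧
    ∀ x : X.carrier, Quotient.mk s x ∈ U → X.RegularAt (f ∘ Quotient.mk s) x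
  congr := by
    rintro f g q h ⟨U, hU, hq, hf⟩
    obtain ⟨V, hV, hVo, hqV⟩ := eventually_nhds_iff.1 h
    refine ⟨U ∩ V, hU.inter hVo, ⟨hq, hqV⟩, fun x hx => X.congr ?_ (hf x hx.1)⟩
    have hc : Continuous (Quotient.mk s) := continuous_quotient_mk'
    exact (hc.tendsto x).eventually (Filter.mem_of_superset (hVo.mem_nhds hx.2) hV)
  eventually := by
    rintro f q ⟨U, hU, hq, hf⟩
    filter_upwards [hU.mem_nhds hq] with r hr
    exact ⟨U, hU, hr, hf⟩

/-- The quotient morphism. -/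
def quotMk (X : SpaceWithFunctions) (s : Setoid X.carrier) : X ⟶ X.quot s where
  toFun := Quotient.mk s
  continuous := continuous_quotient_mk'
  regular := by
    rintro f x ⟨U, _, hx, hf⟩
    exact hf x hx

/-- The morphism out of a quotient induced by an invariant morphism. -/
def quotLift {X Y : SpaceWithFunctions} (s : Setoid X.carrier) (φ : X ⟶ Y)
    (h : ∀ x y, s.r x y → φ.toFun x = φ.toFun y) : X.quot s ⟶ Y where
  toFun := Quotient.lift φ.toFun h
  continuous := φ.continuous.quotient_lift h
  regular := by
    intro f q hf
    obtain ⟨V, hV, hVo, hqV⟩ := eventually_nhds_iff.1 (Y.eventually hf)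
    exact ⟨_, hVo.preimage (φ.continuous.quotient_lift h), hqV,
      fun x hx => φ.regular f x (hV _ hx)⟩

/-- The points of a space with functions, to be given the classical topology. -/
def An (X : SpaceWithFunctions) : Type := X.carrier

/-- The classical (analytic) topology: the coarsest topology in which the Zariski open sets are open
and the regular functions on them are continuous for the usual topology of `ℂ`. -/
instance (X : SpaceWithFunctions) : TopologicalSpace X.An :=
  TopologicalSpace.generateFrom
    {A | ∃ (U : Set X.carrier) (f : X.carrier → ℂ) (W : Set ℂ), IsOpen U ∧
      (∀ x ∈ U, X.RegularAt f x) ∧ IsOpen W ∧ A = {x | x ∈ U ∧ f x ∈ W}}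

end SpaceWithFunctions

open SpaceWithFunctions

/-- The points of affine space with coordinates indexed by `σ`. -/
def AffinePoint (σ : Type) : Type := σ → ℂ

/-- The Zariski topology: the sets `{x | f x ≠ 0}`, `f` a polynomial, are a basis. -/
instance (σ : Type) : TopologicalSpace (AffinePoint σ) :=
  TopologicalSpace.generateFrom
    {U | ∃ f : MvPolynomial σ ℂ, U = {x | MvPolynomial.eval x f ≠ 0}}

lemma isOpen_eval_ne_zero {σ : Type} (f : MvPolynomial σ ℂ) :
    IsOpen {x : AffinePoint σ | MvPolynomial.eval x f ≠ 0} :=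
  TopologicalSpace.isOpen_generateFrom_of_mem ⟨f, rfl⟩

/-- Affine space: regular functions are locally quotients of polynomials. -/
def affineSpace (σ : Type) : SpaceWithFunctions where
  carrier := AffinePoint σ
  RegularAt F x := ∃ g h : MvPolynomial σ ℂ, MvPolynomial.eval x h ≠ 0 ∧
    ∀ᶠ y : AffinePoint σ in 𝓝 x, F y = MvPolynomial.eval y g / MvPolynomial.eval y h
  congr := by
    rintro f f' x hff ⟨g, h, hx, H⟩
    refine ⟨g, h, hx, ?_⟩
    filter_upwards [hff, H] with y hy hy'
    rw [← hy, hy']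
  eventually := by
    rintro f x ⟨g, h, hx, H⟩
    filter_upwards [H.eventually_nhds, (isOpen_eval_ne_zero h).mem_nhds hx] with y hy hy'
    exact ⟨g, h, hy', hy⟩

/-- A smooth affine variety presented by equations in the complement of a hypersurface of
affine space, the gradients of the equations being linearly independent. -/
structure SmoothModel where
  σ : Type
  κ : Type
  [finite_σ : Finite σ]
  [finite_κ : Finite κ]
  eqn : κ → MvPolynomial σ ℂ
  den : MvPolynomial σ ℂ
  smooth : ∀ x : σ → ℂ, (∀ k, MvPolynomial.eval x (eqn k) = 0) → MvPolynomial.eval x den ≠ 0 →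
    LinearIndependent ℂ fun (k : κ) (i : σ) => MvPolynomial.eval x (MvPolynomial.pderiv i (eqn k))

namespace SmoothModel

/-- The set of points of the variety. -/
def locus (M : SmoothModel) : Set (affineSpace M.σ).carrier :=
  {x | (∀ k, MvPolynomial.eval x (M.eqn k) = 0) ∧ MvPolynomial.eval x M.den ≠ 0}

/-- The variety, with its Zariski topology and regular functions. -/
def space (M : SmoothModel) : SpaceWithFunctions := (affineSpace M.σ).sub M.locus

end SmoothModel

/-- A complex algebraic manifold: a smooth, separated complex algebraic variety of finite type. -/
structure IsAlgebraicManifold (X : SpaceWithFunctions) : Prop where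
  quasiCompact : CompactSpace X.carrier
  locallySmooth : ∀ x : X.carrier, ∃ U : Set X.carrier, IsOpen U ∧ x ∈ U ∧
    ∃ M : SmoothModel, Nonempty (X.sub U ≅ M.space)
  separated : ∀ (M : SmoothModel) (φ ψ : M.space ⟶ X), IsClosed {z | φ.toFun z = ψ.toFun z}

/-- Complex algebraic manifolds. -/
structure AlgebraicManifold where
  space : SpaceWithFunctions
  isManifold : IsAlgebraicManifold space

/-- The category of complex algebraic manifolds and regular maps. -/
instance : Category AlgebraicManifold where
  Hom X Y := X.space ⟶ Y.space
  id X := 𝟙 X.space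
  comp φ ψ := SpaceWithFunctions.instCategory.comp φ ψ

namespace AlgebraicManifold

/-- The set of points, with the classical topology. -/
abbrev An (X : AlgebraicManifold) : Type := X.space.An

/-- The map on points of a morphism. -/
def Hom.map {X Y : AlgebraicManifold} (φ : X ⟶ Y) : X.An → Y.An :=
  SpaceWithFunctions.Hom.toFun (X := X.space) (Y := Y.space) φ

end AlgebraicManifold

/-! ## The category of universal coverings of complex algebraic manifolds -/

/-- A universal covering of a complex algebraic manifold: a covering space, for the classical
topology, whose restriction to each connected component of the manifold is simply connected. -/
structure UniversalCovering where
  base : AlgebraicManifold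
  total : Type
  [topology : TopologicalSpace total]
  proj : total → base.An
  isCoveringMap : IsCoveringMap proj
  simplyConnected : ∀ x : base.An, SimplyConnectedSpace (proj ⁻¹' connectedComponent x)

namespace UniversalCovering

instance (X : UniversalCovering) : TopologicalSpace X.total := X.topology

/-- Morphisms are commutative squares, with a regular map at the bottom. -/
@[ext] structure Hom (X Y : UniversalCovering) where
  base : X.base ⟶ Y.base
  total : C(X.total, Y.total)
  comm : ∀ x, Y.proj (total x) = AlgebraicManifold.Hom.map base (X.proj x)

instance : Category UniversalCovering where
  Hom := Hom
  id X := ⟨𝟙 X.base, ContinuousMap.id _, fun _ => rfl⟩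
  comp φ ψ := ⟨φ.base ≫ ψ.base, ψ.total.comp φ.total, fun x =>
    (ψ.comm (φ.total x)).trans (congrArg (AlgebraicManifold.Hom.map ψ.base) (φ.comm x))⟩

/-- The functor that forgets the covering space. -/
def forget : UniversalCovering ⥤ AlgebraicManifold where
  obj X := X.base
  map φ := Hom.base φ

end UniversalCovering

/-! # Truncated simplicial objects -/

/-- The full subcategory, on the ordinals `[n] = {0, …, n}` with `r ≤ n ≤ s`, of the category of
finite ordinals and strictly order preserving maps. -/
abbrev TruncatedDelta (r s : ℕ) :=
  ObjectProperty.FullSubcategory fun a : SemiSimplexCategory => r ≤ a.len ∧ a.len ≤ s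

/-- `(r, s)` truncated (strict) simplicial objects. -/
abbrev TruncatedSimplicialObject (r s : ℕ) (C : Type*) [Category C] :=
  (TruncatedDelta r s)ᵒᵖ ⥤ C

/-! # The generic part of the Grassmannian -/

/-- The `j`th vector of an `(n+1)`-tuple of vectors of `ℂ^p`. -/
def vec {p n : ℕ} (v : (affineSpace (Fin (n + 1) × Fin p)).carrier) (j : Fin (n + 1)) :
    Fin p → ℂ := fun i => v (j, i)

/-- The `(n+1)`-tuples of vectors of `ℂ^p` any `p` of which are linearly independent. -/
def genericTuples (p n : ℕ) : Set (affineSpace (Fin (n + 1) × Fin p)).carrier :=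
  {v | ∀ e : Fin p ↪ Fin (n + 1), LinearIndependent ℂ fun k => vec v (e k)}

/-- The variety of generic tuples. -/
abbrev genericTupleSpace (p n : ℕ) : SpaceWithFunctions :=
  (affineSpace (Fin (n + 1) × Fin p)).sub (genericTuples p n)

/-- The orbit relation of the diagonal action of `GL_p(ℂ)`. -/
def orbitSetoid (p n : ℕ) : Setoid (genericTupleSpace p n).carrier where
  r v w := ∃ g : GL (Fin p) ℂ, ∀ j, vec w.1 j = (g : Matrix (Fin p) (Fin p) ℂ).mulVec (vec v.1 j)
  iseqv := by
    refine ⟨fun v => ⟨1, fun j => by simp⟩, ?_, ?_⟩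
    · rintro v w ⟨g, hg⟩
      refine ⟨g⁻¹, fun j => ?_⟩
      rw [hg j, Matrix.mulVec_mulVec, ← Units.val_mul, inv_mul_cancel, Units.val_one,
        Matrix.one_mulVec]
    · rintro u v w ⟨g, hg⟩ ⟨h, hh⟩
      exact ⟨h * g, fun j => by rw [hh j, hg j, Matrix.mulVec_mulVec, Units.val_mul]⟩

/-- The generic part of the Grassmannian of `q`-planes of `ℙ^{p+q}`, where `n = p + q`:
the orbit space of `GL_p(ℂ)` acting on generic tuples. -/
def genericGrassmannian (p n : ℕ) : SpaceWithFunctions :=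
  (genericTupleSpace p n).quot (orbitSetoid p n)

/-! ## Open subsets of the generic Grassmannian are complex algebraic manifolds -/

section Affine

lemma coord_eq {σ : Type} (y : σ → ℂ) (i : σ) :
    y i = MvPolynomial.eval y (MvPolynomial.X i) / MvPolynomial.eval y 1 := by simp

lemma const_eq {σ : Type} (y : σ → ℂ) (c : ℂ) :
    c = MvPolynomial.eval y (MvPolynomial.C c) / MvPolynomial.eval y 1 := by simp

variable {σ : Type} {S : Set (affineSpace σ).carrier}

lemma sub_regularAt_iff {f : ((affineSpace σ).sub S).carrier → ℂ}
    {x : ((affineSpace σ).sub S).carrier} :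
    ((affineSpace σ).sub S).RegularAt f x ↔ ∃ g h : MvPolynomial σ ℂ,
      MvPolynomial.eval (x.1 : σ → ℂ) h ≠ 0 ∧ ∀ᶠ y : ((affineSpace σ).sub S).carrier in 𝓝 x,
        f y = MvPolynomial.eval (y.1 : σ → ℂ) g / MvPolynomial.eval (y.1 : σ → ℂ) h := by
  constructor
  · rintro ⟨F, ⟨g, h, hx, H⟩, hf⟩
    refine ⟨g, h, hx, ?_⟩
    have h1 : ∀ᶠ y : S in 𝓝 x, F y.1 =
        MvPolynomial.eval (y.1 : σ → ℂ) g / MvPolynomial.eval (y.1 : σ → ℂ) h :=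
      (continuous_subtype_val.tendsto x).eventually H
    filter_upwards [hf, h1] with y hy hy'
    exact hy.trans hy'
  · rintro ⟨g, h, hx, H⟩
    exact ⟨fun y => MvPolynomial.eval (y : σ → ℂ) g / MvPolynomial.eval (y : σ → ℂ) h,
      ⟨g, h, hx, Filter.Eventually.of_forall fun y => rfl⟩, H⟩

lemma eventually_eval_ne_zero {h : MvPolynomial σ ℂ} {x : ((affineSpace σ).sub S).carrier}
    (hx : MvPolynomial.eval (x.1 : σ → ℂ) h ≠ 0) :
    ∀ᶠ y : ((affineSpace σ).sub S).carrier in 𝓝 x, MvPolynomial.eval (y.1 : σ → ℂ) h ≠ 0 :=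
  ((isOpen_eval_ne_zero h).preimage continuous_subtype_val).mem_nhds hx

lemma regularAt_eval (a : MvPolynomial σ ℂ) (x : ((affineSpace σ).sub S).carrier) :
    ((affineSpace σ).sub S).RegularAt (fun y => MvPolynomial.eval (y.1 : σ → ℂ) a) x :=
  sub_regularAt_iff.2 ⟨a, 1, by simp, Filter.Eventually.of_forall fun y => by simp⟩

lemma regularAt_coord (i : σ) (x : ((affineSpace σ).sub S).carrier) :
    ((affineSpace σ).sub S).RegularAt (fun y => (y.1 : σ → ℂ) i) x :=
  sub_regularAt_iff.2 ⟨MvPolynomial.X i, 1, by simp,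
    Filter.Eventually.of_forall fun y => coord_eq (σ := σ) y.1 i⟩

lemma regularAt_add {f g : ((affineSpace σ).sub S).carrier → ℂ}
    {x : ((affineSpace σ).sub S).carrier} (hf : ((affineSpace σ).sub S).RegularAt f x)
    (hg : ((affineSpace σ).sub S).RegularAt g x) :
    ((affineSpace σ).sub S).RegularAt (fun y => f y + g y) x := by
  obtain ⟨a, b, hb, H⟩ := sub_regularAt_iff.1 hf
  obtain ⟨c, d, hd, K⟩ := sub_regularAt_iff.1 hg
  refine sub_regularAt_iff.2 ⟨a * d + c * b, b * d, by simp [hb, hd], ?_⟩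
  filter_upwards [H, K, eventually_eval_ne_zero hb, eventually_eval_ne_zero hd] with y h1 h2 h3 h4
  rw [h1, h2]
  simp only [map_add, map_mul]
  field_simp

lemma regularAt_mul {f g : ((affineSpace σ).sub S).carrier → ℂ}
    {x : ((affineSpace σ).sub S).carrier} (hf : ((affineSpace σ).sub S).RegularAt f x)
    (hg : ((affineSpace σ).sub S).RegularAt g x) :
    ((affineSpace σ).sub S).RegularAt (fun y => f y * g y) x := by
  obtain ⟨a, b, hb, H⟩ := sub_regularAt_iff.1 hf
  obtain ⟨c, d, hd, K⟩ := sub_regularAt_iff.1 hg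
  refine sub_regularAt_iff.2 ⟨a * c, b * d, by simp [hb, hd], ?_⟩
  filter_upwards [H, K] with y h1 h2
  rw [h1, h2]
  simp only [map_mul]
  rw [div_mul_div_comm]

lemma regularAt_const (c : ℂ) (x : ((affineSpace σ).sub S).carrier) :
    ((affineSpace σ).sub S).RegularAt (fun _ => c) x :=
  sub_regularAt_iff.2 ⟨MvPolynomial.C c, 1, by simp,
    Filter.Eventually.of_forall fun y => const_eq (σ := σ) y.1 c⟩

lemma regularAt_inv {f : ((affineSpace σ).sub S).carrier → ℂ}
    {x : ((affineSpace σ).sub S).carrier} (hf : ((affineSpace σ).sub S).RegularAt f x)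
    (hx : f x ≠ 0) : ((affineSpace σ).sub S).RegularAt (fun y => (f y)⁻¹) x := by
  obtain ⟨a, b, hb, H⟩ := sub_regularAt_iff.1 hf
  refine sub_regularAt_iff.2 ⟨b, a, fun h0 => hx ?_, ?_⟩
  · rw [H.self_of_nhds, h0, zero_div]
  · filter_upwards [H] with y h1
    rw [h1, inv_div]

lemma eventually_ne_zero_of_regularAt {f : ((affineSpace σ).sub S).carrier → ℂ}
    {x : ((affineSpace σ).sub S).carrier} (hf : ((affineSpace σ).sub S).RegularAt f x)
    (hx : f x ≠ 0) : ∀ᶠ y in 𝓝 x, f y ≠ 0 := by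
  obtain ⟨a, b, hb, H⟩ := sub_regularAt_iff.1 hf
  have ha : MvPolynomial.eval (x.1 : σ → ℂ) a ≠ 0 := fun h0 => hx (by
    rw [H.self_of_nhds, h0, zero_div])
  filter_upwards [H, eventually_eval_ne_zero ha, eventually_eval_ne_zero hb] with y h1 h2 h3
  rw [h1]
  exact div_ne_zero h2 h3

lemma regularAt_eval_comp {τ : Type} {φ : ((affineSpace σ).sub S).carrier → τ → ℂ}
    (hφ : ∀ i x, ((affineSpace σ).sub S).RegularAt (fun y => φ y i) x) (a : MvPolynomial τ ℂ)
    (x : ((affineSpace σ).sub S).carrier) :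
    ((affineSpace σ).sub S).RegularAt (fun y => MvPolynomial.eval (φ y) a) x := by
  induction a using MvPolynomial.induction_on with
  | C c => simpa using regularAt_const c x
  | add a b ha hb => simpa using regularAt_add ha hb
  | mul_X a i ha => simpa using regularAt_mul ha (hφ i x)

lemma continuous_of_regularAt {τ : Type} {φ : ((affineSpace σ).sub S).carrier → τ → ℂ}
    (hφ : ∀ i x, ((affineSpace σ).sub S).RegularAt (fun y => φ y i) x) :
    @Continuous _ (AffinePoint τ) _ _ φ := by
  refine continuous_generateFrom_iff.2 ?_
  rintro _ ⟨a, rfl⟩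
  exact isOpen_iff_mem_nhds.2 fun x hx =>
    eventually_ne_zero_of_regularAt (regularAt_eval_comp hφ a x) hx

/-- A map to affine space with regular coordinates is a morphism. -/
def toAffineSpace {τ : Type} (φ : ((affineSpace σ).sub S).carrier → (affineSpace τ).carrier)
    (hφ : ∀ i x, ((affineSpace σ).sub S).RegularAt (fun y => (φ y : τ → ℂ) i) x) :
    (affineSpace σ).sub S ⟶ affineSpace τ where
  toFun := φ
  continuous := continuous_of_regularAt hφ
  regular := by
    rintro f x ⟨a, b, hb, H⟩
    refine SpaceWithFunctions.congr _ ?_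
      (regularAt_mul (regularAt_eval_comp hφ a x) (regularAt_inv (regularAt_eval_comp hφ b x) hb))
    have h1 := ((continuous_of_regularAt hφ).tendsto x).eventually H
    filter_upwards [h1] with y hy
    exact (div_eq_mul_inv _ _).symm.trans hy.symm

lemma isTopologicalBasis_affinePoint (σ : Type) : TopologicalSpace.IsTopologicalBasis
    {U : Set (AffinePoint σ) | ∃ f : MvPolynomial σ ℂ, U = {x | MvPolynomial.eval x f ≠ 0}} := by
  refine ⟨?_, ?_, rfl⟩
  · rintro _ ⟨f, rfl⟩ _ ⟨g, rfl⟩ x hx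
    refine ⟨_, ⟨f * g, rfl⟩, ?_, ?_⟩
    · change MvPolynomial.eval x (f * g) ≠ 0
      rw [map_mul]
      exact mul_ne_zero hx.1 hx.2
    · intro y hy
      change MvPolynomial.eval y (f * g) ≠ 0 at hy
      rw [map_mul] at hy
      exact ⟨left_ne_zero_of_mul hy, right_ne_zero_of_mul hy⟩
  · refine Set.eq_univ_of_forall fun x => ⟨_, ⟨1, rfl⟩, ?_⟩
    change MvPolynomial.eval x 1 ≠ 0
    rw [map_one]
    exact one_ne_zero

instance [Finite σ] : TopologicalSpace.NoetherianSpace (AffinePoint σ) := by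
  have hi : IsInducing (fun x : AffinePoint σ =>
      (MvPolynomial.pointToPoint (k := ℂ) (x : σ → ℂ) :
        PrimeSpectrum (MvPolynomial σ ℂ))) := by
    constructor
    rw [PrimeSpectrum.isTopologicalBasis_basic_opens.eq_generateFrom, induced_generateFrom_eq]
    have hf : ∀ f : MvPolynomial σ ℂ, (fun x : AffinePoint σ =>
        (MvPolynomial.pointToPoint (k := ℂ) (x : σ → ℂ) : PrimeSpectrum (MvPolynomial σ ℂ))) ⁻¹'
        (PrimeSpectrum.basicOpen f : Set (PrimeSpectrum (MvPolynomial σ ℂ))) =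
        {x | MvPolynomial.eval x f ≠ 0} := by
      intro f
      ext x
      exact not_congr (MvPolynomial.mem_vanishingIdeal_singleton_iff (K := ℂ) (k := ℂ) (x : σ → ℂ) f)
    refine congrArg TopologicalSpace.generateFrom ?_
    ext U
    constructor
    · rintro ⟨f, rfl⟩
      exact ⟨_, ⟨f, rfl⟩, hf f⟩
    · rintro ⟨_, ⟨f, rfl⟩, rfl⟩
      exact ⟨f, hf f⟩
  exact hi.noetherianSpace

end Affine

lemma toFun_hom_inv {X Y : SpaceWithFunctions} (e : X ≅ Y) (x : X.carrier) :
    e.inv.toFun (e.hom.toFun x) = x :=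
  congrFun (congrArg SpaceWithFunctions.Hom.toFun e.hom_inv_id) x

lemma toFun_inv_hom {X Y : SpaceWithFunctions} (e : X ≅ Y) (y : Y.carrier) :
    e.hom.toFun (e.inv.toFun y) = y :=
  congrFun (congrArg SpaceWithFunctions.Hom.toFun e.inv_hom_id) y

/-- The points of a smooth model where a further polynomial does not vanish. -/
noncomputable def SmoothModel.localize (M : SmoothModel) (h : MvPolynomial M.σ ℂ) : SmoothModel :=
  letI := M.finite_σ
  letI := M.finite_κ
  { σ := M.σ
    κ := M.κ
    eqn := M.eqn
    den := M.den * h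
    smooth := fun x hx hd => M.smooth x hx (by
      rw [map_mul] at hd
      exact left_ne_zero_of_mul hd) }

/-- An open subset of a space isomorphic to a smooth model is a complex algebraic manifold. -/
lemma isAlgebraicManifold_sub {X : SpaceWithFunctions} {M : SmoothModel} (e : X ≅ M.space)
    {U : Set X.carrier} (hU : IsOpen U) : IsAlgebraicManifold (X.sub U) where
  quasiCompact := by
    have := M.finite_σ
    have h1 : IsInducing (Y := AffinePoint M.σ) (fun x : M.space.carrier => x.1) :=
      IsInducing.subtypeVal
    have h2 : TopologicalSpace.NoetherianSpace M.space.carrier := h1.noetherianSpace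
    have h3 : IsEmbedding e.hom.toFun :=
      Function.LeftInverse.isEmbedding (toFun_hom_inv e) e.inv.continuous e.hom.continuous
    have h4 : TopologicalSpace.NoetherianSpace X.carrier := h3.isInducing.noetherianSpace
    have h5 : IsInducing (Y := X.carrier) (fun x : (X.sub U).carrier => x.1) :=
      IsInducing.subtypeVal
    have h6 : TopologicalSpace.NoetherianSpace (X.sub U).carrier := h5.noetherianSpace
    infer_instance
  locallySmooth := by
    intro x
    obtain ⟨O, hO, hOW⟩ := isOpen_induced_iff.1 (hU.preimage e.inv.continuous)
    have hxO : (e.hom.toFun x.1).1 ∈ O := by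
      have : e.hom.toFun x.1 ∈ e.inv.toFun ⁻¹' U := by
        change e.inv.toFun (e.hom.toFun x.1) ∈ U
        rw [toFun_hom_inv]
        exact x.2
      rwa [← hOW] at this
    obtain ⟨_, ⟨h, rfl⟩, hxh, hhO⟩ :=
      (isTopologicalBasis_affinePoint M.σ).exists_subset_of_mem_open hxO hO
    let ι : X.sub U ⟶ affineSpace M.σ := X.incl U ≫ e.hom ≫ (affineSpace M.σ).incl M.locus
    let U' : Set (X.sub U).carrier := ι.toFun ⁻¹' {y | MvPolynomial.eval y h ≠ 0}
    refine ⟨U', (isOpen_eval_ne_zero h).preimage ι.continuous, hxh, M.localize h, ⟨?_⟩⟩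
    have hι : ∀ u : (X.sub U).carrier, ι.toFun u ∈ M.locus := fun u => (e.hom.toFun u.1).2
    have hloc : ∀ y : (affineSpace M.σ).carrier, y ∈ (M.localize h).locus ↔
        y ∈ M.locus ∧ MvPolynomial.eval y h ≠ 0 := by
      intro y
      change (_ ∧ MvPolynomial.eval y (M.den * h) ≠ 0) ↔
        (_ ∧ MvPolynomial.eval y M.den ≠ 0) ∧ _
      rw [map_mul, mul_ne_zero_iff, and_assoc]
      rfl
    let j : (M.localize h).space ⟶ M.space :=
      codRestrict ((affineSpace M.σ).incl (M.localize h).locus) M.locus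
        fun y => ((hloc y.1).1 y.2).1
    have hj : ∀ y, (j ≫ e.inv).toFun y ∈ U := by
      intro y
      have h1 : j.toFun y ∈ e.inv.toFun ⁻¹' U := by
        rw [← hOW]
        exact hhO ((hloc y.1).1 y.2).2
      exact h1
    have hj' : ∀ y, (codRestrict (j ≫ e.inv) U hj).toFun y ∈ U' := by
      intro y
      change MvPolynomial.eval (e.hom.toFun (e.inv.toFun (j.toFun y))).1 h ≠ 0
      rw [toFun_inv_hom]
      exact ((hloc y.1).1 y.2).2
    refine ⟨codRestrict ((X.sub U).incl U' ≫ ι) (M.localize h).locus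
      (fun u => (hloc _).2 ⟨hι u.1, u.2⟩), codRestrict (codRestrict (j ≫ e.inv) U hj) U' hj',
      ?_, ?_⟩
    · refine SpaceWithFunctions.hom_ext (funext fun u => Subtype.ext (Subtype.ext ?_))
      exact toFun_hom_inv e u.1.1
    · refine SpaceWithFunctions.hom_ext (funext fun y => Subtype.ext ?_)
      change (e.hom.toFun (e.inv.toFun (j.toFun y))).1 = (j.toFun y).1
      rw [toFun_inv_hom]
  separated := by
    intro N φ ψ
    let ι : X.sub U ⟶ affineSpace M.σ := X.incl U ≫ e.hom ≫ (affineSpace M.σ).incl M.locus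
    have hι : Function.Injective ι.toFun := by
      intro u v huv
      have h1 : e.hom.toFun u.1 = e.hom.toFun v.1 := Subtype.ext huv
      have h2 := congrArg e.inv.toFun h1
      rw [toFun_hom_inv, toFun_hom_inv] at h2
      exact Subtype.ext h2
    have hcoord : ∀ (φ : N.space ⟶ affineSpace M.σ) (i : M.σ) (z : N.space.carrier),
        N.space.RegularAt (fun z => (φ.toFun z : M.σ → ℂ) i) z := by
      intro φ i z
      refine φ.regular (fun y => (y : M.σ → ℂ) i) z ?_
      exact ⟨MvPolynomial.X i, 1, by simp, Filter.Eventually.of_forall fun y => coord_eq (σ := M.σ) y i⟩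
    refine ⟨isOpen_iff_mem_nhds.2 fun z hz => ?_⟩
    have hne : ι.toFun (φ.toFun z) ≠ ι.toFun (ψ.toFun z) := fun h => hz (hι h)
    obtain ⟨i, hi⟩ := Function.ne_iff.1 hne
    let f (z : N.space.carrier) : ℂ := (ι.toFun (φ.toFun z) : M.σ → ℂ) i
    let g (z : N.space.carrier) : ℂ := (ι.toFun (ψ.toFun z) : M.σ → ℂ) i
    have hreg : N.space.RegularAt (fun z => f z + (-1) * g z) z :=
      regularAt_add (hcoord (φ ≫ ι) i z) (regularAt_mul (regularAt_const _ z) (hcoord (ψ ≫ ι) i z))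
    have hfg : f z ≠ g z := hi
    have hev := eventually_ne_zero_of_regularAt hreg (by
      rw [neg_one_mul, ← sub_eq_add_neg]
      exact sub_ne_zero.2 hfg)
    refine Filter.mem_of_superset hev fun y hy hy' => hy ?_
    have h3 : φ.toFun y = ψ.toFun y := hy'
    have h4 : f y = g y := congrArg (fun u => (ι.toFun u : M.σ → ℂ) i) h3
    rw [h4, neg_one_mul, add_neg_cancel]

section Chart

open MvPolynomial in
/-- The normal forms of generic tuples: the first `p` vectors are the standard basis. -/
noncomputable def normalForms (p n : ℕ) (hp : p ≤ n + 1) : SmoothModel where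
  σ := Fin (n + 1) × Fin p
  κ := Fin p × Fin p
  eqn k := X (Fin.castLE hp k.1, k.2) - C (if k.1 = k.2 then 1 else 0)
  den := ∏ e : Fin p ↪ Fin (n + 1), (Matrix.of fun k i => X (e k, i)).det
  smooth x _ _ := by
    classical
    have h : (fun (k : Fin p × Fin p) (i : Fin (n + 1) × Fin p) => eval x (pderiv i
        (X (Fin.castLE hp k.1, k.2) - C (if k.1 = k.2 then 1 else 0) :
          MvPolynomial (Fin (n + 1) × Fin p) ℂ))) =
        fun k => Pi.single (Fin.castLE hp k.1, k.2) 1 := by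
      funext k i
      rw [map_sub, pderiv_C, sub_zero, pderiv_X]
      by_cases hi : i = (Fin.castLE hp k.1, k.2)
      · subst hi; simp
      · simp [hi, Ne.symm hi]
    rw [h]
    exact (Pi.linearIndependent_single_one (Fin (n + 1) × Fin p) ℂ).comp
      (fun k : Fin p × Fin p => (Fin.castLE hp k.1, k.2)) (by
        rintro ⟨a, b⟩ ⟨c, d⟩ h
        simp only [Prod.mk.injEq, Fin.castLE_inj] at h
        exact Prod.ext h.1 h.2)

variable {p n : ℕ} (hp : p ≤ n + 1)

lemma eval_normalForms_den (w : Fin (n + 1) × Fin p → ℂ) :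
    MvPolynomial.eval w (normalForms p n hp).den =
      ∏ e : Fin p ↪ Fin (n + 1), (Matrix.of fun k i => w (e k, i)).det := by
  unfold normalForms
  rw [map_prod]
  refine Finset.prod_congr rfl fun e _ => ?_
  rw [RingHom.map_det]
  congr 1
  ext k i
  simp

lemma mem_genericTuples_iff (w : Fin (n + 1) × Fin p → ℂ) :
    (w : (affineSpace (Fin (n + 1) × Fin p)).carrier) ∈ genericTuples p n ↔
      MvPolynomial.eval w (normalForms p n hp).den ≠ 0 := by
  rw [eval_normalForms_den, Finset.prod_ne_zero_iff]
  have h (e : Fin p ↪ Fin (n + 1)) :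
      LinearIndependent ℂ (Matrix.of fun k i => w (e k, i) : Matrix (Fin p) (Fin p) ℂ).row ↔
        (Matrix.of fun k i => w (e k, i) : Matrix (Fin p) (Fin p) ℂ).det ≠ 0 := by
    rw [Matrix.linearIndependent_rows_iff_isUnit, Matrix.isUnit_iff_isUnit_det, isUnit_iff_ne_zero]
  exact ⟨fun H e _ => (h e).1 (H e), fun H e => (h e).2 (H e (Finset.mem_univ e))⟩

/-- The matrix whose columns are the first `p` vectors. -/
def frame (v : (genericTupleSpace p n).carrier) : Matrix (Fin p) (Fin p) ℂ :=
  Matrix.of fun i k => vec v.1 (Fin.castLE hp k) i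

lemma isUnit_frame (v : (genericTupleSpace p n).carrier) : IsUnit (frame hp v) :=
  Matrix.linearIndependent_cols_iff_isUnit.1 (v.2 (Fin.castLEEmb hp))

/-- The tuple in normal form in the orbit of a tuple. -/
noncomputable def normalTuple (v : (genericTupleSpace p n).carrier) :
    Fin (n + 1) × Fin p → ℂ := fun a => ((frame hp v)⁻¹).mulVec (vec v.1 a.1) a.2

lemma regularAt_sum {ι : Type} {σ : Type} {S : Set (affineSpace σ).carrier} (s : Finset ι)
    (f : ι → ((affineSpace σ).sub S).carrier → ℂ) (x : ((affineSpace σ).sub S).carrier)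
    (hf : ∀ i, ((affineSpace σ).sub S).RegularAt (f i) x) :
    ((affineSpace σ).sub S).RegularAt (fun y => ∑ i ∈ s, f i y) x := by
  classical
  induction s using Finset.induction_on with
  | empty => simpa using regularAt_const 0 x
  | insert a s ha ih => simpa [Finset.sum_insert ha] using regularAt_add (hf a) ih

lemma regularAt_prod {ι : Type} {σ : Type} {S : Set (affineSpace σ).carrier} (s : Finset ι)
    (f : ι → ((affineSpace σ).sub S).carrier → ℂ) (x : ((affineSpace σ).sub S).carrier)
    (hf : ∀ i, ((affineSpace σ).sub S).RegularAt (f i) x) :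
    ((affineSpace σ).sub S).RegularAt (fun y => ∏ i ∈ s, f i y) x := by
  classical
  induction s using Finset.induction_on with
  | empty => simpa using regularAt_const 1 x
  | insert a s ha ih => simpa [Finset.prod_insert ha] using regularAt_mul (hf a) ih

lemma regularAt_det {σ : Type} {S : Set (affineSpace σ).carrier}
    (A : ((affineSpace σ).sub S).carrier → Matrix (Fin p) (Fin p) ℂ)
    (x : ((affineSpace σ).sub S).carrier)
    (hA : ∀ i j, ((affineSpace σ).sub S).RegularAt (fun y => A y i j) x) :
    ((affineSpace σ).sub S).RegularAt (fun y => (A y).det) x := by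
  simp only [Matrix.det_apply']
  exact regularAt_sum _ _ _ fun s =>
    regularAt_mul (regularAt_const _ x) (regularAt_prod _ _ _ fun i => hA _ _)

lemma regularAt_normalTuple (a : Fin (n + 1) × Fin p) (v : (genericTupleSpace p n).carrier) :
    (genericTupleSpace p n).RegularAt (fun w => normalTuple hp w a) v := by
  have hfr : ∀ i j, (genericTupleSpace p n).RegularAt (fun w => frame hp w i j) v :=
    fun i j => regularAt_coord (Fin.castLE hp j, i) v
  have h : ∀ w : (genericTupleSpace p n).carrier, normalTuple hp w a =
      ∑ k, ((frame hp w).det⁻¹ * ((frame hp w).updateRow k (Pi.single a.2 1)).det) * vec w.1 a.1 k := by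
    intro w
    change ∑ k, (frame hp w)⁻¹ a.2 k * vec w.1 a.1 k = _
    refine Finset.sum_congr rfl fun k _ => ?_
    rw [Matrix.inv_def, Matrix.smul_apply, Matrix.adjugate_apply, Ring.inverse_eq_inv', smul_eq_mul]
  simp only [h]
  refine regularAt_sum _ _ _ fun k => regularAt_mul (regularAt_mul
    (regularAt_inv (regularAt_det _ v hfr) ?_) (regularAt_det _ v ?_))
    (regularAt_coord (a.1, k) v)
  · exact ((Matrix.isUnit_iff_isUnit_det _).1 (isUnit_frame hp v)).ne_zero
  · intro i j
    by_cases hik : i = k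
    · subst hik
      simpa using regularAt_const ((Pi.single a.2 1 : Fin p → ℂ) j) v
    · simpa [Matrix.updateRow_apply, hik] using hfr i j

lemma vec_normalTuple (v : (genericTupleSpace p n).carrier) (j : Fin (n + 1)) :
    vec (normalTuple hp v) j = ((frame hp v)⁻¹).mulVec (vec v.1 j) := rfl

lemma normalTuple_mem (v : (genericTupleSpace p n).carrier) :
    (normalTuple hp v : (affineSpace (Fin (n + 1) × Fin p)).carrier) ∈
      (normalForms p n hp).locus := by
  constructor
  · rintro ⟨a, b⟩
    have h1 : normalTuple hp v (Fin.castLE hp a, b) = ((frame hp v)⁻¹ * frame hp v) b a := rfl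
    rw [Matrix.nonsing_inv_mul _ ((Matrix.isUnit_iff_isUnit_det _).1 (isUnit_frame hp v)),
      Matrix.one_apply] at h1
    unfold normalForms
    simp [h1, eq_comm]
  · refine (mem_genericTuples_iff hp _).1 fun e => ?_
    have h2 : Function.Injective ((frame hp v)⁻¹).mulVec :=
      Matrix.mulVec_injective_iff_isUnit.2 (Matrix.isUnit_nonsing_inv_iff.2 (isUnit_frame hp v))
    exact (v.2 e).map' (Matrix.mulVecLin (frame hp v)⁻¹)
      (LinearMap.ker_eq_bot.2 h2)

/-- The generic part of the Grassmannian is isomorphic to the variety of normal forms. -/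
noncomputable def genericGrassmannianIso :
    genericGrassmannian p n ≅ (normalForms p n hp).space where
  hom := quotLift (orbitSetoid p n)
    (codRestrict (toAffineSpace (normalTuple hp) (regularAt_normalTuple hp))
      (normalForms p n hp).locus (normalTuple_mem hp)) (by
      rintro v w ⟨g, hg⟩
      refine Subtype.ext ?_
      have hfr : frame hp w = (g : Matrix (Fin p) (Fin p) ℂ) * frame hp v := by
        ext i k
        exact congrFun (hg (Fin.castLE hp k)) i
      have hg' : IsUnit (g : Matrix (Fin p) (Fin p) ℂ).det :=
        (Matrix.isUnit_iff_isUnit_det _).1 g.isUnit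
      have h : ∀ j, vec (normalTuple hp v) j = vec (normalTuple hp w) j := by
        intro j
        rw [vec_normalTuple, vec_normalTuple, hfr, hg j, Matrix.mul_inv_rev,
          Matrix.mulVec_mulVec, Matrix.mul_assoc, Matrix.nonsing_inv_mul _ hg', Matrix.mul_one]
      exact funext fun a => congrFun (h a.1) a.2)
  inv := codRestrict ((affineSpace _).incl (normalForms p n hp).locus) (genericTuples p n)
    (fun x => (mem_genericTuples_iff hp x.1).2 x.2.2) ≫ quotMk _ (orbitSetoid p n)
  hom_inv_id := by
    refine SpaceWithFunctions.hom_ext (funext fun q => ?_)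
    induction q using Quotient.inductionOn with
    | h v =>
      have hu := isUnit_frame hp v
      refine Quotient.sound ⟨hu.unit, fun j => ?_⟩
      change vec v.1 j = (frame hp v).mulVec (((frame hp v)⁻¹).mulVec (vec v.1 j))
      rw [Matrix.mulVec_mulVec, Matrix.mul_nonsing_inv _ ((Matrix.isUnit_iff_isUnit_det _).1 hu),
        Matrix.one_mulVec]
  inv_hom_id := by
    refine SpaceWithFunctions.hom_ext (funext fun x => Subtype.ext ?_)
    let v : (genericTupleSpace p n).carrier := ⟨x.1, (mem_genericTuples_iff hp x.1).2 x.2.2⟩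
    have hfr : frame hp v = 1 := by
      ext i k
      have h1 : ∀ w : Fin (n + 1) × Fin p → ℂ,
          MvPolynomial.eval w ((normalForms p n hp).eqn (k, i)) =
            w (Fin.castLE hp k, i) - if k = i then 1 else 0 := by
        intro w
        unfold normalForms
        by_cases hki : k = i <;> simp [hki]
      have h2 : frame hp v i k = if k = i then 1 else 0 :=
        sub_eq_zero.1 ((h1 x.1).symm.trans (x.2.1 (k, i)))
      rw [h2, Matrix.one_apply]
      simp [eq_comm]
    have h : ∀ j, vec (normalTuple hp v) j = vec v.1 j := by
      intro j
      rw [vec_normalTuple, hfr, inv_one, Matrix.one_mulVec]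
    exact funext fun a => congrFun (h a.1) a.2

end Chart

/-! # Derived configurations, templates and the constructible topology -/

section Templates

variable {V : Type} [AddCommGroup V] [Module ℂ V] {ι : Type}

/-- The linear subspaces of `ℙ(V)` are the subspaces of `V`, the empty one being `⊥`, and the
dimension is one less. The linear span in `ℙ(V)` of a subconfiguration `(x i)`, `i ∈ I`, of a
configuration of points of `ℙ(V)`, i.e. of lines in `V`. -/
def pointSpan (x : ι → Submodule ℂ V) (I : Set ι) : Submodule ℂ V := ⨆ i ∈ I, x i

/-- Hyperplanes of `ℙ(V)`. -/
def IsHyperplane (L : Submodule ℂ V) : Prop := Module.finrank ℂ L + 1 = Module.finrank ℂ V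

/-- The completion of a linear configuration: all non-empty intersections of its members. -/
def completion (H : Set (Submodule ℂ V)) : Set (Submodule ℂ V) :=
  {M | M ≠ ⊥ ∧ ∃ S ⊆ H, S.Nonempty ∧ M = sInf S}

/-- `IsDerived x H`: the linear configuration `H` is derived from the configuration of points `x`. -/
inductive IsDerived (x : ι → Submodule ℂ V) : Set (Submodule ℂ V) → Prop
  | base : IsDerived x (completion {L | IsHyperplane L ∧ ∃ I, L = pointSpan x I})
  | step (H : Set (Submodule ℂ V)) (L : Submodule ℂ V) (I : Set ι) : IsDerived x H → L ∈ H →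
      IsHyperplane (L ⊔ pointSpan x I) → IsDerived x (completion (H ∪ {L ⊔ pointSpan x I}))

/-- A partially ordered set with an order preserving rank function and `n + 1` marked elements of
rank zero. -/
structure MarkedPoset (n : ℕ) where
  carrier : Type
  [order : PartialOrder carrier]
  rank : carrier →o ℕ
  mark : Fin (n + 1) → carrier
  rank_mark : ∀ j, rank (mark j) = 0

instance (n : ℕ) (P : MarkedPoset n) : PartialOrder P.carrier := P.order

/-- Isomorphism of marked partially ordered sets with rank functions. -/
def markedPosetSetoid (n : ℕ) : Setoid (MarkedPoset n) where
  r P Q := ∃ e : P.carrier ≃o Q.carrier,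
    (∀ a, Q.rank (e a) = P.rank a) ∧ ∀ j, e (P.mark j) = Q.mark j
  iseqv := by
    refine ⟨fun P => ⟨OrderIso.refl _, fun _ => rfl, fun _ => rfl⟩, ?_, ?_⟩
    · rintro P Q ⟨e, h1, h2⟩
      exact ⟨e.symm, fun a => by rw [← h1, e.apply_symm_apply],
        fun j => by rw [← h2, e.symm_apply_apply]⟩
    · rintro P Q R ⟨e, h1, h2⟩ ⟨f, h3, h4⟩
      exact ⟨e.trans f, fun a => by rw [OrderIso.trans_apply, h3, h1],
        fun j => by rw [OrderIso.trans_apply, h2, h4]⟩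

/-- `n`-marked templates: isomorphism classes of marked partially ordered sets. -/
def MarkedTemplate (n : ℕ) : Type 1 := Quotient (markedPosetSetoid n)

/-- The template of a linear configuration, marked by the points `x j`: order by inclusion,
rank given by the dimension of projective linear subspaces. -/
noncomputable def templateOf [FiniteDimensional ℂ V] {n : ℕ} (H : Set (Submodule ℂ V))
    (x : Fin (n + 1) → Submodule ℂ V) (hx : ∀ j, x j ∈ H) (h1 : ∀ j, Module.finrank ℂ (x j) = 1) :
    MarkedTemplate n :=
  Quotient.mk (markedPosetSetoid n)
    { carrier := H
      rank := ⟨fun L => Module.finrank ℂ L.1 - 1,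
        fun _ _ h => Nat.sub_le_sub_right (Submodule.finrank_mono h) 1⟩
      mark := fun j => ⟨x j, hx j⟩
      rank_mark := fun j => (congrArg (· - 1) (h1 j) : Module.finrank ℂ (x j) - 1 = 0) }

/-- The set of marked templates of the linear configurations derived from a configuration of points. -/
def templates [FiniteDimensional ℂ V] {n : ℕ} (x : Fin (n + 1) → Submodule ℂ V) :
    Set (MarkedTemplate n) :=
  {T | ∃ (H : Set (Submodule ℂ V)) (hx : ∀ j, x j ∈ H) (h1 : ∀ j, Module.finrank ℂ (x j) = 1),
    IsDerived x H ∧ T = templateOf H x hx h1}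

end Templates

/-- The configuration of points of `ℙ^{p-1}` given by a tuple of vectors of `ℂ^p`. -/
def pointConfiguration {p n : ℕ} (v : (genericTupleSpace p n).carrier) (j : Fin (n + 1)) :
    Submodule ℂ (Fin p → ℂ) := Submodule.span ℂ {vec v.1 j}

/-- The Zariski closure of the set of points of the generic Grassmannian to whose configuration of
points (well defined up to projective equivalence) the template `T` is associated. -/
def templateClosure (p n : ℕ) (T : MarkedTemplate n) : Set (genericGrassmannian p n).carrier :=
  closure {g | ∃ v, Quotient.mk (orbitSetoid p n) v = g ∧ T ∈ templates (pointConfiguration v)}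

/-- The constructible topology: the coarsest one in which all these Zariski closures are closed. -/
abbrev constructibleTopologyOn (p n : ℕ) : TopologicalSpace (genericGrassmannian p n).carrier :=
  TopologicalSpace.generateFrom {U | ∃ T : MarkedTemplate n, U = (templateClosure p n T)ᶜ}

lemma isOpen_of_constructible {p n : ℕ} {U : Set (genericGrassmannian p n).carrier}
    (hU : IsOpen[constructibleTopologyOn p n] U) : IsOpen U := by
  have h : (genericGrassmannian p n).zariski ≤ constructibleTopologyOn p n := by
    refine le_generateFrom ?_
    rintro _ ⟨T, rfl⟩
    exact isClosed_closure.isOpen_compl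
  exact h U hU

/-! # The truncated simplicial variety and its constructible open subsets -/

/-- The map `(v_0, …, v_n) ↦ (v_{f 0}, …, v_{f m})` on tuples of vectors. -/
def reindexTuple {p m n : ℕ} (f : Fin (m + 1) ↪o Fin (n + 1))
    (v : (affineSpace (Fin (n + 1) × Fin p)).carrier) :
    (affineSpace (Fin (m + 1) × Fin p)).carrier :=
  fun a => (v : Fin (n + 1) × Fin p → ℂ) (f a.1, a.2)

lemma reindexTuple_mem {p m n : ℕ} (f : Fin (m + 1) ↪o Fin (n + 1))
    (v : (genericTupleSpace p n).carrier) : reindexTuple f v.1 ∈ genericTuples p m :=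
  fun e => v.2 (e.trans f.toEmbedding)

/-- The same map, as a morphism of the varieties of generic tuples. -/
def selectTuple (p : ℕ) {m n : ℕ} (f : Fin (m + 1) ↪o Fin (n + 1)) :
    genericTupleSpace p n ⟶ genericTupleSpace p m :=
  codRestrict (toAffineSpace (fun v => reindexTuple f v.1)
    fun a v => regularAt_coord (f a.1, a.2) v) (genericTuples p m) (reindexTuple_mem f)

/-- The morphism of generic Grassmannians given by selecting vectors. If `f` omits exactly the
value `i`, this is the `i`th face map. -/
def selectVectors (p : ℕ) {m n : ℕ} (f : Fin (m + 1) ↪o Fin (n + 1)) :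
    genericGrassmannian p n ⟶ genericGrassmannian p m :=
  quotLift (orbitSetoid p n) (selectTuple p f ≫ quotMk _ (orbitSetoid p m)) (by
    rintro v w ⟨g, hg⟩
    exact Quotient.sound ⟨g, fun j => hg (f j)⟩)

lemma selectVectors_refl (p n : ℕ) (q : (genericGrassmannian p n).carrier) :
    (selectVectors p (RelEmbedding.refl _ : Fin (n + 1) ↪o Fin (n + 1))).toFun q = q := by
  induction q using Quotient.inductionOn with
  | h v => rfl

lemma selectVectors_trans (p : ℕ) {l m n : ℕ} (f : Fin (l + 1) ↪o Fin (m + 1))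
    (g : Fin (m + 1) ↪o Fin (n + 1)) (q : (genericGrassmannian p n).carrier) :
    (selectVectors p (f.trans g)).toFun q =
      (selectVectors p f).toFun ((selectVectors p g).toFun q) := by
  induction q using Quotient.inductionOn with
  | h v => rfl

/-- A constructible open subset of the truncated simplicial variety whose term in degree
`n = p + q`, `0 ≤ q ≤ p`, is the generic part of the Grassmannian of `q`-planes of `ℙ^{p+q}`. -/
structure ConstructibleOpen (p : ℕ) where
  carrier : ∀ a : TruncatedDelta p (2 * p), Set (genericGrassmannian p a.obj.len).carrier
  isOpen : ∀ a, IsOpen[constructibleTopologyOn p a.obj.len] (carrier a)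
  mapsTo : ∀ {a b : TruncatedDelta p (2 * p)} (f : a ⟶ b),
    Set.MapsTo (selectVectors p (SemiSimplexCategory.homEquiv f.hom)).toFun (carrier b) (carrier a)

namespace ConstructibleOpen

variable {p : ℕ}

/-- The inclusion order; it makes constructible open subsets the objects of a category whose
morphisms are the inclusions. -/
instance : Preorder (ConstructibleOpen p) where
  le V U := ∀ a, V.carrier a ⊆ U.carrier a
  le_refl _ _ := le_rfl
  le_trans _ _ _ h k a := (h a).trans (k a)

/-- The whole truncated simplicial variety is the largest constructible open subset. -/
instance : OrderTop (ConstructibleOpen p) where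
  top := ⟨fun _ => Set.univ, fun a => @isOpen_univ _ (constructibleTopologyOn p a.obj.len),
    fun _ => Set.mapsTo_univ _ _⟩
  le_top _ _ := Set.subset_univ _

/-- The terms of a constructible open subset are complex algebraic manifolds. -/
def manifold (U : ConstructibleOpen p) (a : TruncatedDelta p (2 * p)) : AlgebraicManifold where
  space := (genericGrassmannian p a.obj.len).sub (U.carrier a)
  isManifold := isAlgebraicManifold_sub
    (genericGrassmannianIso (a.property.1.trans (Nat.le_succ _))) (isOpen_of_constructible (U.isOpen a))

/-- A constructible open subset as a truncated simplicial object of the category of complex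
algebraic manifolds. -/
def simplicialManifold (U : ConstructibleOpen p) :
    TruncatedSimplicialObject p (2 * p) AlgebraicManifold where
  obj a := U.manifold a.unop
  map {b a} f := codRestrict ((genericGrassmannian p b.unop.obj.len).incl (U.carrier b.unop) ≫
    selectVectors p (SemiSimplexCategory.homEquiv f.unop.hom)) (U.carrier a.unop)
    fun x => U.mapsTo f.unop x.2
  map_id a := SpaceWithFunctions.hom_ext (funext fun x => Subtype.ext
    ((congrArg (fun h => (selectVectors p h).toFun x.1)
      (SemiSimplexCategory.homEquiv_id a.unop.obj)).trans (selectVectors_refl p _ x.1)))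
  map_comp f g := SpaceWithFunctions.hom_ext (funext fun x => Subtype.ext
    ((congrArg (fun h => (selectVectors p h).toFun x.1)
      (SemiSimplexCategory.homEquiv_comp g.unop.hom f.unop.hom)).trans
        (selectVectors_trans p _ _ x.1)))

/-- The inclusion morphism. -/
def inclusion {V U : ConstructibleOpen p} (h : V ≤ U) :
    V.simplicialManifold ⟶ U.simplicialManifold where
  app a := codRestrict ((genericGrassmannian p a.unop.obj.len).incl (V.carrier a.unop))
    (U.carrier a.unop) fun x => h a.unop x.2
  naturality _ _ _ := rfl

end ConstructibleOpen

/-- The functor from the ordered set of constructible open subsets to truncated simplicial complex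
algebraic manifolds that sends inclusions to inclusions. -/
def constructibleOpens (p : ℕ) :
    ConstructibleOpen p ⥤ TruncatedSimplicialObject p (2 * p) AlgebraicManifold where
  obj U := U.simplicialManifold
  map h := ConstructibleOpen.inclusion h.le
  map_id _ := rfl
  map_comp _ _ := rfl

/-! Lifts of a map to universal coverings are determined only up to deck transformations, so strict
functoriality needs base points compatible with all faces and all inclusions. A base point can be
replaced by a simply connected region mapped into the manifold: a lift of the region to the covering
rigidifies it just as well. Once every manifold has such a region, and every morphism a compatible
map of regions, there is exactly one lift of each morphism that respects the lifted regions
(`exists_isLift`, `IsLift.unique`). Uniqueness then gives the functor laws, whatever coverings were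
chosen.

The regions consist of orbits of tuples whose coordinates are real and grow very rapidly in the
lexicographic order, vector index first. A nonzero polynomial cannot vanish on a family that grows
fast enough, because the powers of the largest variable dominate (`exists_one_le_norm_eval`). Hence
every nonempty Zariski open set contains all sufficiently rapid tuples
(`exists_rapidRegion_subset`). The families of rapidity `c` form a convex set, these sets decrease
with `c`, and they are stable under restriction to a subset of the indices, hence under omission of
vectors. The base region of a term is the union of those for which every face of every tuple lies in
the given open subset. It is convex as a nested union, nonempty when the term is, compatible with
faces, and monotone in the open subset because no threshold is chosen.

Constructible open sets enter only as Zariski open sets. In normal form, with the first `p` vectors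
the standard basis, they are Zariski open in an affine space. They are therefore path connected and
locally convex in the classical topology if nonempty, and have universal coverings by the usual
construction with homotopy classes of paths. -/

/-! # Existence of universal coverings -/

/-! ### Calculus of homotopy classes of paths -/

namespace Path.Homotopic.Quotient

variable {X Y : Type*} [TopologicalSpace X] [TopologicalSpace Y]

lemma map_trans' {a b c : X} (γ : Path.Homotopic.Quotient a b) (δ : Path.Homotopic.Quotient b c)
    (f : C(X, Y)) : (γ.trans δ).map f = (γ.map f).trans (δ.map f) :=
  (FundamentalGroupoid.map f).map_comp (X := ⟨a⟩) (Y := ⟨b⟩) (Z := ⟨c⟩) γ δ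

lemma symm_of_trans {a b c : X} (γ : Path.Homotopic.Quotient a b)
    (δ : Path.Homotopic.Quotient b c) : (γ.trans δ).symm = δ.symm.trans γ.symm := by
  induction γ using Path.Homotopic.Quotient.ind with | mk γ =>
  induction δ using Path.Homotopic.Quotient.ind with | mk δ =>
  rw [← mk_trans, ← mk_symm, ← mk_symm, ← mk_symm, ← mk_trans, Path.trans_symm]

lemma trans_symm_trans_cancel {a b c : X} (γ : Path.Homotopic.Quotient a b)
    (δ : Path.Homotopic.Quotient a c) : γ.trans (γ.symm.trans δ) = δ := by
  rw [← trans_assoc, trans_symm, refl_trans]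

lemma symm_trans_trans_cancel {a b c : X} (γ : Path.Homotopic.Quotient b a)
    (δ : Path.Homotopic.Quotient a c) : γ.symm.trans (γ.trans δ) = δ := by
  rw [← trans_assoc, symm_trans, refl_trans]

lemma trans_trans_symm_trans {a b c d : X} (γ : Path.Homotopic.Quotient a b)
    (δ : Path.Homotopic.Quotient b c) (ε : Path.Homotopic.Quotient d b) :
    (γ.trans δ).trans (ε.trans δ).symm = γ.trans ε.symm := by
  rw [symm_of_trans, trans_assoc, trans_symm_trans_cancel]

lemma trans_symm_trans_trans_symm {a b c d : X} (γ : Path.Homotopic.Quotient a b)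
    (δ : Path.Homotopic.Quotient c b) (ε : Path.Homotopic.Quotient d b) :
    (γ.trans δ.symm).trans (δ.trans ε.symm) = γ.trans ε.symm := by
  rw [trans_assoc, symm_trans_trans_cancel]

/-- The homotopy class of the paths between two points inside a simply connected subset. -/
noncomputable def within (U : Set X) [SimplyConnectedSpace U] (a b : U) :
    Path.Homotopic.Quotient (a : X) (b : X) :=
  (mk (PathConnectedSpace.somePath a b)).map ⟨Subtype.val, continuous_subtype_val⟩

/-- All paths in `U` with the same ends are homotopic, so the path chosen in `within` does not
matter. -/
lemma within_eq_mk (U : Set X) [SimplyConnectedSpace U] {a b : U} (γ : Path (a : X) (b : X))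
    (hγ : ∀ t, γ t ∈ U) : within U a b = mk γ := by
  unfold within
  let δ : Path a b := ⟨⟨fun t => ⟨γ t, hγ t⟩, by fun_prop⟩, by ext; simp, by ext; simp⟩
  rw [Subsingleton.elim (mk (PathConnectedSpace.somePath a b)) (mk δ)]
  rfl

lemma within_trans (U : Set X) [SimplyConnectedSpace U] (a b c : U) :
    (within U a b).trans (within U b c) = within U a c := by
  unfold within
  rw [← map_trans']
  congr 1
  exact Subsingleton.elim _ _

end Path.Homotopic.Quotient

/-! ### The universal covering as a bundle with fibre the fundamental group -/

open Path.Homotopic (Quotient)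

/-- A locally path connected space with a base point joined to every point, and a simply connected
open neighbourhood of every point. -/
structure SimplyConnectedNeighborhoods (X : Type) [TopologicalSpace X] (x₀ : X) where
  nbhd : X → Set X
  isOpen : ∀ x, IsOpen (nbhd x)
  mem : ∀ x, x ∈ nbhd x
  simplyConnected : ∀ x, SimplyConnectedSpace (nbhd x)
  locallyPathConnected : LocallyPathConnectedSpace X
  center : ∀ x, Quotient x₀ x

namespace SimplyConnectedNeighborhoods

variable {X : Type} [TopologicalSpace X] {x₀ : X} (N : SimplyConnectedNeighborhoods X x₀)

instance (i : X) : SimplyConnectedSpace (N.nbhd i) := N.simplyConnected i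

open Classical in
/-- The class of the paths that go to the centre of a neighbourhood and then stay inside. -/
noncomputable def toPoint (i x : X) : Quotient x₀ x :=
  if h : x ∈ N.nbhd i then (N.center i).trans (.within (N.nbhd i) ⟨i, N.mem i⟩ ⟨x, h⟩)
  -- An arbitrary value outside the neighbourhood. It makes `toPoint` total, and the cocycle
  -- identities hold for any choice.
  else N.center x

/-- Moving the end point inside a neighbourhood does not change the homotopical choice made at its
centre. This is why coordinate changes are locally constant and why path lifts are continuous. -/
lemma toPoint_trans {i x y : X} (γ : Path x y) (hγ : ∀ t, γ t ∈ N.nbhd i) :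
    (N.toPoint i x).trans (.mk γ) = N.toPoint i y := by
  have hx : x ∈ N.nbhd i := by simpa using hγ 0
  have hy : y ∈ N.nbhd i := by simpa using hγ 1
  rw [toPoint, toPoint, dif_pos hx, dif_pos hy, Path.Homotopic.Quotient.trans_assoc,
    ← Path.Homotopic.Quotient.within_eq_mk (N.nbhd i) (a := ⟨x, hx⟩) (b := ⟨y, hy⟩) γ hγ,
    Path.Homotopic.Quotient.within_trans]

/-- The fibre over the base point, with the discrete topology. -/
def Fiber (_ : SimplyConnectedNeighborhoods X x₀) : Type := Quotient x₀ x₀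

instance : TopologicalSpace N.Fiber := ⊥
instance : DiscreteTopology N.Fiber := ⟨rfl⟩

/-- The change of coordinates between two neighbourhoods. -/
noncomputable def coordChange (i j x : X) (g : N.Fiber) : N.Fiber :=
  (Path.Homotopic.Quotient.trans g ((N.toPoint i x).trans (N.toPoint j x).symm) :)

lemma coordChange_eq_of_joinedIn {i j x y : X} (h : JoinedIn (N.nbhd i ∩ N.nbhd j) x y)
    (g : N.Fiber) : N.coordChange i j y g = N.coordChange i j x g := by
  obtain ⟨γ, hγ⟩ := h
  unfold coordChange
  rw [← N.toPoint_trans γ fun t => (hγ t).1, ← N.toPoint_trans γ fun t => (hγ t).2,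
    Path.Homotopic.Quotient.trans_trans_symm_trans]

/-- The universal covering as a fibre bundle. -/
noncomputable def bundle : FiberBundleCore X X N.Fiber where
  baseSet := N.nbhd
  isOpen_baseSet := N.isOpen
  indexAt := id
  mem_baseSet_at := N.mem
  coordChange := N.coordChange
  coordChange_self i x _ g := by
    unfold coordChange
    rw [Path.Homotopic.Quotient.trans_symm]
    exact Path.Homotopic.Quotient.trans_refl (X := X) g
  continuousOn_coordChange i j := by
    rintro ⟨x, g⟩ ⟨hx, -⟩
    have := N.locallyPathConnected
    refine ContinuousAt.continuousWithinAt ?_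
    -- The path component of `x` in the intersection is a neighbourhood of `x`, and the fibre is
    -- discrete, so the coordinate change is constant near `(x, g)`.
    have h1 : ∀ᶠ q : X × N.Fiber in 𝓝 (x, g), N.coordChange i j q.1 q.2 = N.coordChange i j x g := by
      rw [nhds_prod_eq, nhds_discrete N.Fiber]
      have h2 := pathComponentIn_mem_nhds (((N.isOpen i).inter (N.isOpen j)).mem_nhds hx)
      filter_upwards [Filter.prod_mem_prod h2 (Filter.mem_pure.2 (Set.mem_singleton g))]
      rintro ⟨y, g'⟩ ⟨hy, rfl⟩
      exact N.coordChange_eq_of_joinedIn hy _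
    exact (Filter.EventuallyEq.continuousAt h1 :)
  coordChange_comp i j k x _ g := by
    unfold coordChange
    refine (Path.Homotopic.Quotient.trans_assoc (X := X) g _ _).trans ?_
    rw [Path.Homotopic.Quotient.trans_symm_trans_trans_symm]

/-- The total space of the universal covering. -/
abbrev Cover : Type := N.bundle.TotalSpace

lemma isCoveringMap_proj : IsCoveringMap N.bundle.proj := FiberBundle.isCoveringMap (F := N.Fiber) (E := N.bundle.Fiber)

/-- The point of the covering given by the class of a path from the base point. -/
noncomputable def point {x : X} (γ : Quotient x₀ x) : N.Cover :=
  ⟨x, (γ.trans (N.toPoint x x).symm :)⟩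

lemma point_injective {x : X} : Function.Injective (N.point (x := x)) := by
  intro γ δ h
  have h1 : γ.trans (N.toPoint x x).symm = δ.trans (N.toPoint x x).symm :=
    eq_of_heq (Bundle.TotalSpace.mk.inj h).2
  have h2 := congrArg (fun η => Path.Homotopic.Quotient.trans η (N.toPoint x x)) h1
  simpa using h2

/-- A coordinate `g` over `x`, read in the chart centred at `x`, stands for the class `g` followed
by `N.toPoint x x`. -/
lemma point_surjective (e : N.Cover) : ∃ γ : Quotient x₀ e.proj, N.point γ = e := by
  obtain ⟨x, g⟩ := e
  refine ⟨Path.Homotopic.Quotient.trans g (N.toPoint x x), ?_⟩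
  unfold point
  congr 1
  refine (Path.Homotopic.Quotient.trans_assoc (X := X) g _ _).trans ?_
  rw [Path.Homotopic.Quotient.trans_symm]
  exact Path.Homotopic.Quotient.trans_refl (X := X) g

/-! ### Path lifting and simple connectivity of the covering -/

instance : SimplyConnectedSpace unitInterval :=
  have : ContractibleSpace unitInterval :=
    (convex_Icc (0 : ℝ) 1).contractibleSpace (Set.nonempty_Icc.2 zero_le_one)
  inferInstance

instance : LocallyPathConnectedSpace unitInterval :=
  (convex_Icc (0 : ℝ) 1).locallyPathConnectedSpace

/-- The class of the initial segments of a path. -/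
noncomputable def segment (γ : C(unitInterval, X)) (t : unitInterval) : Quotient (γ 0) (γ t) :=
  Path.Homotopic.Quotient.map (.mk (PathConnectedSpace.somePath 0 t)) γ

/-- This curve of initial segments is the lift of `γ`. In the chart centred at `γ t` its coordinate
is constant near `t`, since a short further piece of `γ` stays in the neighbourhood and cancels. -/
lemma continuous_point_segment {x₀ : X} (N : SimplyConnectedNeighborhoods X x₀)
    (γ : C(unitInterval, X)) (h : x₀ = γ 0) :
    Continuous fun t => N.point ((segment γ t).cast h rfl) := by
  subst h
  simp only [Path.Homotopic.Quotient.cast_rfl_rfl]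
  refine continuous_iff_continuousAt.2 fun t => ?_
  rw [FiberBundle.continuousAt_totalSpace N.Fiber]
  refine ⟨γ.continuous.continuousAt, ?_⟩
  have h1 := pathComponentIn_mem_nhds
    (((N.isOpen (γ t)).preimage γ.continuous).mem_nhds (N.mem (γ t)))
  refine Filter.EventuallyEq.continuousAt
    (y := ((segment γ t).trans (N.toPoint (γ t) (γ t)).symm :)) ?_
  filter_upwards [h1] with s hs
  obtain ⟨δ, hδ⟩ := hs
  have h2 : segment γ s = (segment γ t).trans (.mk (δ.map γ.continuous)) := by
    unfold segment
    rw [Path.Homotopic.Quotient.mk_map, ← Path.Homotopic.Quotient.map_trans']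
    congr 1
    -- Both classes live in the simply connected unit interval, so no reparametrization is needed.
    exact Subsingleton.elim _ _
  change Path.Homotopic.Quotient.trans ((segment γ s).trans (N.toPoint (γ s) (γ s)).symm)
    ((N.toPoint (γ s) (γ s)).trans (N.toPoint (γ t) (γ s)).symm) = _
  rw [Path.Homotopic.Quotient.trans_symm_trans_trans_symm, h2,
    ← N.toPoint_trans (i := γ t) (δ.map γ.continuous) hδ,
    Path.Homotopic.Quotient.trans_trans_symm_trans]

lemma segment_one (γ : C(unitInterval, X)) :
    segment γ 1 = .mk ⟨γ, rfl, rfl⟩ := by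
  let δ : Path (0 : unitInterval) 1 := ⟨ContinuousMap.id _, rfl, rfl⟩
  unfold segment
  rw [Subsingleton.elim (Path.Homotopic.Quotient.mk (PathConnectedSpace.somePath 0 1)) (.mk δ)]
  rfl

/-- The base point of the covering. -/
noncomputable def basePoint : N.Cover := N.point (.refl x₀)

lemma point_cast {x y : X} (γ : Quotient x₀ x) (h : y = x) :
    N.point (γ.cast rfl h) = N.point γ := by
  subst h
  rw [Path.Homotopic.Quotient.cast_rfl_rfl]

lemma point_segment_zero {x₀ : X} (N : SimplyConnectedNeighborhoods X x₀)
    (γ : C(unitInterval, X)) (h : x₀ = γ 0) :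
    N.point ((segment γ 0).cast h rfl) = N.basePoint := by
  subst h
  unfold segment basePoint
  rw [Path.Homotopic.Quotient.cast_rfl_rfl,
    Subsingleton.elim (Path.Homotopic.Quotient.mk (PathConnectedSpace.somePath 0 0))
      (.refl (0 : unitInterval))]
  rfl

lemma exists_path_to_point {x : X} (γ : Path x₀ x) :
    ∃ δ : Path N.basePoint (N.point (.mk γ)), ∀ t, (δ t).proj = γ t := by
  refine ⟨⟨⟨_, N.continuous_point_segment γ γ.source.symm⟩, ?_, ?_⟩, fun t => rfl⟩
  · exact N.point_segment_zero γ γ.source.symm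
  · refine Eq.trans ?_ (N.point_cast (.mk γ) γ.target)
    change N.point ((segment γ 1).cast γ.source.symm rfl) = _
    rw [segment_one]
    rfl

/-- By uniqueness of path lifting, a path from the base point is the lift by initial segments of its
own projection, so that projection determines its end. -/
lemma point_map_proj (e : N.Cover) (δ : Quotient N.basePoint e) :
    N.point (δ.map ⟨N.bundle.proj, N.bundle.continuous_proj⟩) = e := by
  induction δ using Path.Homotopic.Quotient.ind with | mk δ =>
  let γ : Path x₀ e.proj := δ.map N.bundle.continuous_proj
  obtain ⟨ε, hε⟩ := N.exists_path_to_point γ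
  have h1 : (ε : unitInterval → N.Cover) = δ :=
    N.isCoveringMap_proj.eq_of_comp_eq ε.continuous δ.continuous (funext fun t => hε t) 0
      (ε.source.trans δ.source.symm)
  exact ε.target.symm.trans ((congrFun h1 1).trans δ.target)

instance : SimplyConnectedSpace N.Cover := by
  have h1 : ∀ e : N.Cover, Joined N.basePoint e := by
    intro e
    obtain ⟨γ, hγ⟩ := N.point_surjective e
    obtain ⟨δ, rfl⟩ := Path.Homotopic.Quotient.mk_surjective γ
    have h : Joined N.basePoint (N.point (.mk δ)) := ⟨(N.exists_path_to_point δ).choose⟩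
    exact hγ ▸ h
  refine simply_connected_iff_paths_homotopic.2
    ⟨⟨⟨N.basePoint⟩, fun e e' => (h1 e).symm.trans (h1 e')⟩, fun e e' => ⟨fun γ δ => ?_⟩⟩
  -- Preceded by `α`, both paths start at the base point. Their projections then represent the same
  -- point `e'`, hence are homotopic, and the covering map is injective on homotopy classes.
  let α : Quotient N.basePoint e := .mk (h1 e).somePath
  have h2 : α.trans γ = α.trans δ :=
    N.isCoveringMap_proj.injective_path_homotopic_map _ _
      (N.point_injective ((N.point_map_proj e' _).trans (N.point_map_proj e' _).symm))
  have h3 := congrArg (Path.Homotopic.Quotient.trans α.symm) h2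
  rwa [Path.Homotopic.Quotient.symm_trans_trans_cancel,
    Path.Homotopic.Quotient.symm_trans_trans_cancel] at h3

end SimplyConnectedNeighborhoods

lemma IsLocalHomeomorph.locallyPathConnectedSpace {X Y : Type*} [TopologicalSpace X]
    [TopologicalSpace Y] [LocallyPathConnectedSpace Y] {f : X → Y} (hf : IsLocalHomeomorph f) :
    LocallyPathConnectedSpace X := by
  choose e he _ using hf
  let C : ChartedSpace Y X :=
    { atlas := Set.range e
      chartAt := e
      mem_chart_source := he
      chart_mem_atlas := fun x => ⟨x, rfl⟩ }
  exact ChartedSpace.locallyPathConnectedSpace Y X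

/-- A path connected and locally path connected space in which every point has a simply connected
open neighbourhood has a universal covering. -/
theorem exists_universalCovering (X : Type) [TopologicalSpace X] [PathConnectedSpace X]
    [LocallyPathConnectedSpace X]
    (h : ∀ x : X, ∃ U : Set X, IsOpen U ∧ x ∈ U ∧ SimplyConnectedSpace U) :
    ∃ (E : Type) (_ : TopologicalSpace E) (f : E → X), IsCoveringMap f ∧ SimplyConnectedSpace E ∧
      LocallyPathConnectedSpace E ∧ Function.Surjective f := by
  choose U h1 h2 h3 using h
  obtain ⟨x₀⟩ := PathConnectedSpace.nonempty (X := X)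
  let N : SimplyConnectedNeighborhoods X x₀ :=
    ⟨U, h1, h2, h3, inferInstance, fun x => .mk (PathConnectedSpace.somePath x₀ x)⟩
  exact ⟨N.Cover, inferInstance, N.bundle.proj, N.isCoveringMap_proj, inferInstance,
    N.isCoveringMap_proj.isLocalHomeomorph.locallyPathConnectedSpace,
    fun x => ⟨N.point (.mk (PathConnectedSpace.somePath x₀ x)), rfl⟩⟩

namespace SpaceWithFunctions

/-- Morphisms are continuous for the classical topology. -/
lemma continuous_an {X Y : SpaceWithFunctions} (φ : X ⟶ Y) :
    Continuous (X := X.An) (Y := Y.An) φ.toFun := by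
  refine continuous_generateFrom_iff.2 ?_
  rintro _ ⟨U, f, W, hU, hf, hW, rfl⟩
  exact TopologicalSpace.isOpen_generateFrom_of_mem ⟨φ.toFun ⁻¹' U, f ∘ φ.toFun, W,
    hU.preimage φ.continuous, fun x hx => φ.regular f x (hf _ hx), hW, rfl⟩

end SpaceWithFunctions

/-! # Functorial universal coverings of manifolds with a simply connected base region -/

/-- A complex algebraic manifold that has a universal covering, with a simply connected region in it
that serves as a base point. -/
structure BasedManifold where
  base : AlgebraicManifold
  region : Type
  [topology : TopologicalSpace region]
  incl : C(region, base.An)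
  simplyConnected : Nonempty region → SimplyConnectedSpace region
  locallyPathConnected : LocallyPathConnectedSpace region
  nonempty : Nonempty base.An → Nonempty region
  pathConnected : Nonempty base.An → PathConnectedSpace base.An
  locallyPathConnected_base : LocallyPathConnectedSpace base.An
  nbhd : ∀ x : base.An, ∃ U : Set base.An, IsOpen U ∧ x ∈ U ∧ SimplyConnectedSpace U

namespace BasedManifold

instance (X : BasedManifold) : TopologicalSpace X.region := X.topology

/-- Morphisms are regular maps with a compatible map of base regions. -/
@[ext] structure Hom (X Y : BasedManifold) where
  base : X.base ⟶ Y.base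
  region : C(X.region, Y.region)
  comm : ∀ r, Y.incl (region r) = AlgebraicManifold.Hom.map base (X.incl r)

instance : Category BasedManifold where
  Hom := Hom
  id X := ⟨𝟙 X.base, ContinuousMap.id _, fun _ => rfl⟩
  comp φ ψ := ⟨φ.base ≫ ψ.base, ψ.region.comp φ.region, fun r =>
    (ψ.comm (φ.region r)).trans (congrArg (AlgebraicManifold.Hom.map ψ.base) (φ.comm r))⟩

/-- A universal covering with a lift of the base region. -/
structure Covering (X : BasedManifold) where
  total : Type
  [topology : TopologicalSpace total]
  proj : total → X.base.An
  section_ : C(X.region, total)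
  proj_section : ∀ r, proj (section_ r) = X.incl r
  isCoveringMap : IsCoveringMap proj
  simplyConnected : Nonempty total → SimplyConnectedSpace total
  locallyPathConnected : LocallyPathConnectedSpace total
  surjective : Function.Surjective proj

/-- The region is simply connected and locally path connected, so its map to the base lifts to any
covering once one value is prescribed. -/
lemma nonempty_covering (X : BasedManifold) : Nonempty X.Covering := by
  rcases isEmpty_or_nonempty X.base.An with h | h
  -- An empty base forces an empty region, and the empty covering serves.
  · have h1 : IsEmpty X.region := ⟨fun r => h.false (X.incl r)⟩
    exact ⟨{
      total := Empty
      proj := Empty.elim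
      section_ := ⟨fun r => h1.elim r, continuous_of_const fun r => h1.elim r⟩
      proj_section := fun r => h1.elim r
      isCoveringMap := IsCoveringMap.of_isEmpty _
      simplyConnected := fun h => h.elim Empty.elim
      locallyPathConnected := ⟨fun x => x.elim⟩
      surjective := fun x => h.elim x }⟩
  · have := X.pathConnected h
    have := X.locallyPathConnected_base
    have h1 := X.nonempty h
    have := X.simplyConnected h1
    have := X.locallyPathConnected
    obtain ⟨E, _, f, hf, h2, h3, h4⟩ := exists_universalCovering X.base.An X.nbhd
    obtain ⟨r⟩ := h1
    obtain ⟨e, he⟩ := h4 (X.incl r)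
    obtain ⟨s, ⟨-, hs⟩, -⟩ := hf.existsUnique_continuousMap_lifts X.incl r e he
    exact ⟨{
      total := E
      proj := f
      section_ := s
      proj_section := congrFun hs
      isCoveringMap := hf
      simplyConnected := fun _ => h2
      locallyPathConnected := h3
      surjective := h4 }⟩

/-- A chosen universal covering with a lift of the base region. -/
noncomputable def covering (X : BasedManifold) : X.Covering := Classical.choice X.nonempty_covering

instance (X : BasedManifold) (C : X.Covering) : TopologicalSpace C.total := C.topology

/-- The chosen universal covering as an object of the category of universal coverings. -/
noncomputable def cover (X : BasedManifold) : UniversalCovering where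
  base := X.base
  total := X.covering.total
  proj := X.covering.proj
  isCoveringMap := X.covering.isCoveringMap
  simplyConnected x := by
    have h1 := X.pathConnected ⟨x⟩
    obtain ⟨e, -⟩ := X.covering.surjective x
    have h2 := X.covering.simplyConnected ⟨e⟩
    rw [PreconnectedSpace.connectedComponent_eq_univ, Set.preimage_univ]
    exact (Homeomorph.Set.univ X.covering.total).toHomotopyEquiv.simplyConnectedSpace

/-- `T` is a lift of the morphism `φ` that is compatible with the lifts of the base regions. -/
def IsLift {X Y : BasedManifold} (φ : X ⟶ Y) (T : C(X.covering.total, Y.covering.total)) : Prop :=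
  (∀ e, Y.covering.proj (T e) = AlgebraicManifold.Hom.map (Hom.base φ) (X.covering.proj e)) ∧
    ∀ r, T (X.covering.section_ r) = Y.covering.section_ (Hom.region φ r)

lemma exists_isLift {X Y : BasedManifold} (φ : X ⟶ Y) : ∃ T, IsLift φ T := by
  rcases isEmpty_or_nonempty X.covering.total with h | h
  · exact ⟨⟨fun e => h.elim e, continuous_of_const fun e => h.elim e⟩, fun e => h.elim e,
      fun r => h.elim (X.covering.section_ r)⟩
  · have := X.covering.simplyConnected h
    have := X.covering.locallyPathConnected
    obtain ⟨r⟩ := X.nonempty (h.map X.covering.proj)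
    have := X.simplyConnected ⟨r⟩
    let f : C(X.covering.total, Y.base.An) := ⟨fun e =>
      AlgebraicManifold.Hom.map (Hom.base φ) (X.covering.proj e),
      (continuous_an (X := X.base.space) (Y := Y.base.space) (Hom.base φ)).comp
        X.covering.isCoveringMap.continuous⟩
    have hproj : ∀ r, Y.covering.proj (Y.covering.section_ (Hom.region φ r)) =
        f (X.covering.section_ r) := fun r => by
      change _ = AlgebraicManifold.Hom.map (Hom.base φ) (X.covering.proj _)
      rw [Y.covering.proj_section, X.covering.proj_section]
      exact Hom.comm φ r
    obtain ⟨T, ⟨hT, hTf⟩, -⟩ := Y.covering.isCoveringMap.existsUnique_continuousMap_lifts f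
      (X.covering.section_ r) (Y.covering.section_ (Hom.region φ r)) (hproj r)
    -- The lift is fixed at one point of the region. Both sides lift the same map on the region,
    -- which is connected, so they agree on all of it.
    refine ⟨T, congrFun hTf, congrFun (Y.covering.isCoveringMap.eq_of_comp_eq
      (T.continuous.comp X.covering.section_.continuous)
      (Y.covering.section_.continuous.comp (Hom.region φ).continuous)
      (funext fun s => ?_) r hT)⟩
    exact (congrFun hTf _).trans (hproj s).symm

/-- Two lifts agree on the lifted region, which is nonempty whenever the covering is, and the
covering space is connected. -/
lemma IsLift.unique {X Y : BasedManifold} {φ : X ⟶ Y} {S T : C(X.covering.total, Y.covering.total)}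
    (hS : IsLift φ S) (hT : IsLift φ T) : S = T := by
  rcases isEmpty_or_nonempty X.covering.total with h | h
  · ext e
    exact h.elim e
  · have := X.covering.simplyConnected h
    obtain ⟨r⟩ := X.nonempty (h.map X.covering.proj)
    refine DFunLike.coe_injective (Y.covering.isCoveringMap.eq_of_comp_eq S.continuous T.continuous
      (funext fun e => (hS.1 e).trans (hT.1 e).symm) (X.covering.section_ r)
      ((hS.2 r).trans (hT.2 r).symm))

/-- The functor to universal coverings. -/
noncomputable def universalCovering : BasedManifold ⥤ UniversalCovering where
  obj := cover
  map {X Y} φ := ⟨Hom.base φ, (exists_isLift φ).choose, (exists_isLift φ).choose_spec.1⟩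
  map_id X := by
    refine UniversalCovering.Hom.ext rfl ?_
    exact (exists_isLift (𝟙 X)).choose_spec.unique ⟨fun _ => rfl, fun _ => rfl⟩
  map_comp {X Y Z} φ ψ := by
    refine UniversalCovering.Hom.ext rfl ?_
    have h1 := (exists_isLift φ).choose_spec
    have h2 := (exists_isLift ψ).choose_spec
    -- The composite of the chosen lifts respects the lifted regions, hence is the chosen lift of
    -- the composite.
    refine (exists_isLift (φ ≫ ψ)).choose_spec.unique (T := (exists_isLift ψ).choose.comp
      (exists_isLift φ).choose) ⟨fun e => ?_, fun r => ?_⟩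
    · exact (h2.1 _).trans (congrArg (AlgebraicManifold.Hom.map ψ.base) (h1.1 e))
    · exact (congrArg _ (h1.2 r)).trans (h2.2 _)

end BasedManifold

/-! # The classical topology of quasi-affine varieties -/

section ClassicalTopology

variable {σ : Type}

/-- The classical topology of a subset of affine space is finer than the Zariski topology. -/
lemma continuous_toZariski (S : Set (σ → ℂ)) :
    Continuous (X := S) (Y := ((affineSpace σ).sub S).carrier) fun x => x := by
  have h : Continuous (X := S) (Y := AffinePoint σ) fun x => x.1 := by
    refine continuous_generateFrom_iff.2 ?_
    rintro _ ⟨a, rfl⟩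
    exact isOpen_ne.preimage ((MvPolynomial.continuous_eval a).comp continuous_subtype_val)
  exact h.subtype_mk fun x => x.2

/-- Regular functions are locally quotients of polynomials, hence continuous for the usual topology.
Conversely the coordinates are regular, which gives `continuous_fromAn`. -/
lemma continuous_toAn (S : Set (σ → ℂ)) :
    Continuous (X := S) (Y := ((affineSpace σ).sub S).An) fun x => x := by
  refine continuous_generateFrom_iff.2 ?_
  rintro _ ⟨U, f, W, hU, hf, hW, rfl⟩
  refine isOpen_iff_mem_nhds.2 ?_
  rintro x ⟨hxU, hxW⟩
  obtain ⟨a, b, hb, H⟩ := sub_regularAt_iff.1 (hf x hxU)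
  have hz := (continuous_toZariski S).tendsto x
  have h1 : ∀ᶠ y : S in 𝓝 x, y ∈ U := hz.eventually (hU.mem_nhds hxU)
  have h2 : ∀ᶠ y : S in 𝓝 x, f y = MvPolynomial.eval y.1 a / MvPolynomial.eval y.1 b :=
    hz.eventually H
  have hp : ∀ a : MvPolynomial σ ℂ, Continuous fun y : S => MvPolynomial.eval y.1 a :=
    fun a => (MvPolynomial.continuous_eval a).comp continuous_subtype_val
  have h3 : Filter.Tendsto (fun y : S => MvPolynomial.eval y.1 a / MvPolynomial.eval y.1 b)
      (𝓝 x) (𝓝 (f x)) := by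
    rw [H.self_of_nhds]
    exact ((hp a).tendsto x).div ((hp b).tendsto x) hb
  filter_upwards [h1, h2, h3.eventually (hW.mem_nhds hxW)] with y hy1 hy2 hy3
  refine ⟨hy1, ?_⟩
  rw [hy2]
  exact hy3

lemma continuous_fromAn (S : Set (σ → ℂ)) :
    Continuous (X := ((affineSpace σ).sub S).An) (Y := S) fun x => x := by
  let c : ((affineSpace σ).sub S).carrier → σ → ℂ := fun x => x.1
  have h : Continuous (X := ((affineSpace σ).sub S).An) (Y := σ → ℂ) fun x => c x :=
    continuous_pi fun i => continuous_def.2 fun W hW =>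
      TopologicalSpace.isOpen_generateFrom_of_mem ⟨Set.univ, fun x => c x i, W, isOpen_univ,
        fun x _ => regularAt_coord i x, hW, Set.ext fun x => ⟨fun h => ⟨trivial, h⟩, fun h => h.2⟩⟩
  exact h.subtype_mk fun x => x.2

/-- The classical topology on a subset of affine space is the subspace topology. -/
def coordinateHomeomorph (S : Set (σ → ℂ)) : ((affineSpace σ).sub S).An ≃ₜ S where
  toFun x := x
  invFun x := x
  left_inv _ := rfl
  right_inv _ := rfl
  continuous_toFun := continuous_fromAn S
  continuous_invFun := continuous_toAn S

/-- Isomorphic spaces with functions are homeomorphic in the classical topology. -/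
def homeomorphAn {X Y : SpaceWithFunctions} (e : X ≅ Y) : X.An ≃ₜ Y.An where
  toFun := e.hom.toFun
  invFun := e.inv.toFun
  left_inv := toFun_hom_inv e
  right_inv := toFun_inv_hom e
  continuous_toFun := continuous_an e.hom
  continuous_invFun := continuous_an e.inv

end ClassicalTopology

/-! # Zariski open subsets of affine subspaces -/

/-- `O` is a Zariski open subset of `A`, and `A` contains the complex line through any two of its
points. -/
structure IsZariskiOpenIn {σ : Type} (O A : Set (σ → ℂ)) : Prop where
  line_mem : ∀ a ∈ A, ∀ b ∈ A, ∀ z : ℂ, a + z • (b - a) ∈ A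
  subset : O ⊆ A
  exists_eval : ∀ a ∈ O, ∃ f : MvPolynomial σ ℂ, MvPolynomial.eval a f ≠ 0 ∧
    ∀ x ∈ A, MvPolynomial.eval x f ≠ 0 → x ∈ O

namespace IsZariskiOpenIn

variable {σ : Type} {O A : Set (σ → ℂ)} (h : IsZariskiOpenIn O A)
include h

lemma convex : Convex ℝ A := by
  intro a ha b hb s t hs ht hst
  have h1 := h.line_mem a ha b hb t
  convert h1 using 1
  ext i
  simp only [Pi.add_apply, Pi.smul_apply, Pi.sub_apply, smul_eq_mul, Complex.real_smul]
  have : (s : ℂ) = 1 - t := by rw [eq_sub_iff_add_eq]; exact_mod_cast hst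
  rw [this]
  ring

/-- The complex line through two points of `O` leaves `O` only at zeros of a nonzero polynomial in
one variable, and the complement of a finite set in `ℂ` is path connected. -/
lemma isPathConnected (hne : O.Nonempty) : IsPathConnected O := by
  obtain ⟨a, ha⟩ := hne
  refine ⟨a, ha, fun {b} hb => ?_⟩
  obtain ⟨f, hfa, hf⟩ := h.exists_eval a ha
  let l : ℂ → σ → ℂ := fun z => a + z • (b - a)
  let P : Polynomial ℂ := MvPolynomial.aeval
    (fun i => Polynomial.C (a i) + Polynomial.X * Polynomial.C (b i - a i)) f
  have hP : ∀ z, P.eval z = MvPolynomial.eval (l z) f := by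
    intro z
    have h1 : (Polynomial.evalRingHom z).comp (MvPolynomial.aeval (R := ℂ)
        (fun i => Polynomial.C (a i) + Polynomial.X * Polynomial.C (b i - a i))).toRingHom =
        MvPolynomial.eval (l z) := by
      ext i
      · simp
      · simp [l]
    exact congrArg (fun φ => φ f) h1
  -- Its value at `0` is the value of `f` at `a`.
  have hP0 : P ≠ 0 := by
    intro h0
    have := hP 0
    rw [h0] at this
    simp [l] at this
    exact hfa this.symm
  let Z : Set ℂ := {z | l z ∉ O}
  have hZ : Z.Finite := by
    refine (P.roots.toFinset.finite_toSet).subset fun z hz => ?_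
    by_contra hroot
    refine hz (hf _ (h.line_mem a (h.subset ha) b (h.subset hb) z) ?_)
    rw [← hP]
    intro h0
    exact hroot (by simpa [hP0] using h0)
  have h2 : IsPathConnected Zᶜ := hZ.countable.isPathConnected_compl_of_one_lt_rank (by
    rw [Complex.rank_real_complex]
    exact Nat.one_lt_ofNat)
  have h3 : JoinedIn Zᶜ 0 1 := h2.joinedIn 0 (by simpa [Z, l] using ha) 1 (by simpa [Z, l] using hb)
  obtain ⟨γ, hγ⟩ := h3
  have hl : Continuous l := by fun_prop
  refine ⟨(γ.map hl).cast (by simp [l]) (by simp [l]), fun t => ?_⟩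
  exact not_not.1 (hγ t)

lemma exists_ball [Fintype σ] (x : O) : ∃ ε > 0, Metric.ball (x : σ → ℂ) ε ∩ A ⊆ O := by
  obtain ⟨f, hfx, hf⟩ := h.exists_eval x x.2
  obtain ⟨ε, hε, hb⟩ := Metric.isOpen_iff.1
    (isOpen_ne.preimage (MvPolynomial.continuous_eval f)) (x : σ → ℂ) hfx
  exact ⟨ε, hε, fun y hy => hf y hy.2 (hb hy.1)⟩

lemma image_ball [Fintype σ] {x : O} {r : ℝ} (hr : Metric.ball (x : σ → ℂ) r ∩ A ⊆ O) :
    Subtype.val '' Metric.ball x r = Metric.ball (x : σ → ℂ) r ∩ A := by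
  have h1 : Metric.ball x r = Subtype.val ⁻¹' Metric.ball (x : σ → ℂ) r := rfl
  rw [h1, Subtype.image_preimage_coe]
  exact Set.Subset.antisymm (fun y hy => ⟨hy.2, h.subset hy.1⟩) fun y hy => ⟨hr hy, hy.1⟩

/-- Small balls of `O` are intersections of balls with the convex set `A`, hence convex.
`exists_simplyConnected` holds for the same reason. -/
lemma locallyPathConnectedSpace [Finite σ] : LocallyPathConnectedSpace O := by
  have := Fintype.ofFinite σ
  refine LocallyPathConnectedSpace.of_bases
    (p := fun x r => 0 < r ∧ Metric.ball (x : σ → ℂ) r ∩ A ⊆ O) (s := fun x r => Metric.ball x r)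
    (fun x => ?_) fun x r hr => ?_
  · obtain ⟨ε, hε, hb⟩ := h.exists_ball x
    refine (Metric.nhds_basis_ball (x := x)).to_hasBasis (fun r hr => ?_)
      fun r hr => ⟨r, hr.1, subset_rfl⟩
    exact ⟨min r ε, ⟨lt_min hr hε, fun y hy => hb
      ⟨Metric.ball_subset_ball (min_le_right _ _) hy.1, hy.2⟩⟩,
      Metric.ball_subset_ball (min_le_left _ _)⟩
  · rw [IsInducing.subtypeVal.isPathConnected_iff, h.image_ball hr.2]
    exact ((convex_ball _ _).inter h.convex).isPathConnected
      ⟨x, Metric.mem_ball_self hr.1, h.subset x.2⟩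

lemma exists_simplyConnected [Finite σ] (x : O) : ∃ U : Set O, IsOpen U ∧ x ∈ U ∧ SimplyConnectedSpace U := by
  have := Fintype.ofFinite σ
  obtain ⟨ε, hε, hb⟩ := h.exists_ball x
  refine ⟨Metric.ball x ε, Metric.isOpen_ball, Metric.mem_ball_self hε, ?_⟩
  have h1 : IsSimplyConnected (Metric.ball (x : σ → ℂ) ε ∩ A) := by
    have : ContractibleSpace ↑(Metric.ball (x : σ → ℂ) ε ∩ A) :=
      ((convex_ball _ _).inter h.convex).contractibleSpace
        ⟨x, Metric.mem_ball_self hε, h.subset x.2⟩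
    exact (inferInstance : SimplyConnectedSpace ↑(Metric.ball (x : σ → ℂ) ε ∩ A))
  rw [← h.image_ball hb, IsEmbedding.subtypeVal.isSimplyConnected_image] at h1
  exact h1

end IsZariskiOpenIn

/-! # Open subsets of smooth models -/

section OpenSubsets

variable {X : SpaceWithFunctions} {M : SmoothModel} (e : X ≅ M.space) (U : Set X.carrier)

/-- The subset of affine space that corresponds to a subset of a space isomorphic to a smooth
model. -/
def affineImage : Set (M.σ → ℂ) := {x | ∃ h : x ∈ M.locus, e.inv.toFun ⟨x, h⟩ ∈ U}

/-- A subset of a space isomorphic to a smooth model as a subset of affine space. -/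
noncomputable def subIsoAffineImage : X.sub U ≅ (affineSpace M.σ).sub (affineImage e U) where
  hom := codRestrict (X.incl U ≫ e.hom ≫ (affineSpace M.σ).incl M.locus) (affineImage e U)
    fun x => ⟨(e.hom.toFun x.1).2, by
      change e.inv.toFun (e.hom.toFun x.1) ∈ U
      rw [toFun_hom_inv]
      exact x.2⟩
  inv := codRestrict (codRestrict ((affineSpace M.σ).incl (affineImage e U)) M.locus
    (fun x => x.2.1) ≫ e.inv) U fun x => x.2.2
  hom_inv_id := SpaceWithFunctions.hom_ext (funext fun x => Subtype.ext (toFun_hom_inv e x.1))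
  inv_hom_id := SpaceWithFunctions.hom_ext (funext fun x => Subtype.ext
    (congrArg (fun y : M.space.carrier => y.1) (toFun_inv_hom e ⟨x.1, x.2.1⟩)))

/-- A subset of a space isomorphic to a smooth model, with the classical topology, as a subset of
affine space. -/
noncomputable def anHomeomorph : (X.sub U).An ≃ₜ affineImage e U :=
  (homeomorphAn (subIsoAffineImage e U)).trans (coordinateHomeomorph _)

variable {U} in
lemma isZariskiOpenIn_affineImage (hU : IsOpen U)
    (hM : ∀ a b : M.σ → ℂ, (∀ k, MvPolynomial.eval a (M.eqn k) = 0) →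
      (∀ k, MvPolynomial.eval b (M.eqn k) = 0) → ∀ (z : ℂ) (k),
      MvPolynomial.eval (a + z • (b - a)) (M.eqn k) = 0) :
    IsZariskiOpenIn (affineImage e U)
      {x | ∀ k, MvPolynomial.eval x (M.eqn k) = 0} where
  line_mem a ha b hb := hM a b ha hb
  subset x hx := hx.1.1
  exists_eval a ha := by
    obtain ⟨V, hV, hVU⟩ := isOpen_induced_iff.1 (hU.preimage e.inv.continuous)
    have hmem : ∀ x : M.space.carrier, x.1 ∈ V ↔ e.inv.toFun x ∈ U := fun x =>
      iff_of_eq (congrArg (fun s => x ∈ s) hVU)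
    obtain ⟨_, ⟨h, rfl⟩, hah, hhV⟩ := (isTopologicalBasis_affinePoint M.σ).exists_subset_of_mem_open
      ((hmem ⟨a, ha.1⟩).2 ha.2) hV
    -- The factor `M.den` forces solutions of the equations back into the locus of the model.
    refine ⟨h * M.den, ?_, fun x hx hne => ?_⟩
    · rw [map_mul]
      exact mul_ne_zero hah ha.1.2
    · rw [map_mul, mul_ne_zero_iff] at hne
      have hx' : x ∈ M.locus := ⟨hx, hne.2⟩
      exact ⟨hx', (hmem ⟨x, hx'⟩).1 (hhV hne.1)⟩

end OpenSubsets

/-! ### Classical topology of open subsets of the generic Grassmannian -/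

section Grassmannian

variable {p n : ℕ} (hp : p ≤ n + 1)

lemma eval_normalForms_eqn (w : Fin (n + 1) × Fin p → ℂ) (k : Fin p × Fin p) :
    MvPolynomial.eval w ((normalForms p n hp).eqn k) =
      w (Fin.castLE hp k.1, k.2) - if k.1 = k.2 then 1 else 0 := by
  unfold normalForms
  by_cases hk : k.1 = k.2 <;> simp [hk]

instance : Finite (normalForms p n hp).σ := (normalForms p n hp).finite_σ

/-- The equations of the normal forms prescribe the entries of the first `p` vectors, so their
solutions form an affine subspace. -/
lemma isZariskiOpenIn_grassmannian {U : Set (genericGrassmannian p n).carrier} (hU : IsOpen U) :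
    IsZariskiOpenIn (affineImage (genericGrassmannianIso hp) U)
    {x | ∀ k, MvPolynomial.eval x ((normalForms p n hp).eqn k) = 0} := by
  refine isZariskiOpenIn_affineImage (genericGrassmannianIso hp) hU fun a b ha hb z k => ?_
  have h := eval_normalForms_eqn hp
  have ha' := sub_eq_zero.1 ((h a k).symm.trans (ha k))
  have hb' := sub_eq_zero.1 ((h b k).symm.trans (hb k))
  refine (h (a + z • (b - a)) k).trans ?_
  change a _ + z * (b _ - a _) - _ = 0
  rw [ha', hb']
  ring

variable {U : Set (genericGrassmannian p n).carrier}
include hp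

lemma pathConnectedSpace_grassmannian (hU : IsOpen U)
    (hne : Nonempty ((genericGrassmannian p n).sub U).An) :
    PathConnectedSpace ((genericGrassmannian p n).sub U).An := by
  let e := anHomeomorph (genericGrassmannianIso hp) U
  have h1 := (isZariskiOpenIn_grassmannian hp hU).isPathConnected
    (Set.nonempty_coe_sort.1 (hne.map e))
  have h2 := isPathConnected_iff_pathConnectedSpace.1 h1
  exact e.symm.surjective.pathConnectedSpace e.symm.continuous

lemma locallyPathConnectedSpace_grassmannian (hU : IsOpen U) :
    LocallyPathConnectedSpace ((genericGrassmannian p n).sub U).An := by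
  have := (isZariskiOpenIn_grassmannian hp hU).locallyPathConnectedSpace
  exact (anHomeomorph (genericGrassmannianIso hp) U).isOpenEmbedding.locallyPathConnectedSpace

lemma exists_simplyConnected_grassmannian (hU : IsOpen U)
    (x : ((genericGrassmannian p n).sub U).An) :
    ∃ W : Set ((genericGrassmannian p n).sub U).An, IsOpen W ∧ x ∈ W ∧ SimplyConnectedSpace W := by
  let e := anHomeomorph (genericGrassmannianIso hp) U
  obtain ⟨W, hW, hxW, h⟩ := (isZariskiOpenIn_grassmannian hp hU).exists_simplyConnected (e x)
  exact ⟨e ⁻¹' W, hW.preimage e.continuous, hxW, e.isSimplyConnected_preimage.2 h⟩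

end Grassmannian

/-! # Rapidly increasing families of real numbers -/

section RapidRegion

variable {ι κ : Type} [LinearOrder ι] [LinearOrder κ]

/-- The families of real numbers that increase rapidly, `c` being the measure of rapidity. -/
def rapidRegion (ι : Type) [LinearOrder ι] (c : ℕ) : Set (ι → ℝ) :=
  {t | (∀ i, (c : ℝ) < t i) ∧ ∀ i j, i < j → t i ^ c < t j}

lemma rapidRegion_antitone : Antitone (rapidRegion ι) := by
  intro c d hcd t ht
  have hcd' : (c : ℝ) ≤ d := by exact_mod_cast hcd
  refine ⟨fun i => hcd'.trans_lt (ht.1 i), fun i j hij => ?_⟩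
  -- Powers increase with the exponent only for bases at least `1`, which `d < t i` ensures unless
  -- `d = 0`.
  rcases Nat.eq_zero_or_pos d with rfl | hd
  · rw [Nat.le_zero.1 hcd]
    exact ht.2 i j hij
  · have h1 : (1 : ℝ) ≤ d := by exact_mod_cast hd
    exact (pow_le_pow_right₀ (h1.trans (ht.1 i).le) hcd).trans_lt (ht.2 i j hij)

/-- The function `x ↦ x ^ c` is convex on nonnegative reals, so the power of a convex combination is
at most the combination of the powers. -/
lemma convex_rapidRegion (c : ℕ) : Convex ℝ (rapidRegion ι c) := by
  intro t ht u hu a b ha hb hab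
  have hc : (0 : ℝ) ≤ c := Nat.cast_nonneg c
  have key : ∀ x y : ℝ, ∀ i, x < t i → y < u i → a * x + b * y < a * t i + b * u i := by
    intro x y i hx hy
    rcases ha.eq_or_lt with rfl | ha'
    · have hb1 : b = 1 := by linarith
      subst hb1
      linarith
    · exact add_lt_add_of_lt_of_le (mul_lt_mul_of_pos_left hx ha')
        (mul_le_mul_of_nonneg_left hy.le hb)
  refine ⟨fun i => ?_, fun i j hij => ?_⟩
  · have h := key c c i (ht.1 i) (hu.1 i)
    rw [← add_mul, hab, one_mul] at h
    exact h
  · have h1 := (convexOn_pow c).2 (hc.trans (ht.1 i).le : t i ∈ Set.Ici (0 : ℝ))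
      (hc.trans (hu.1 i).le : u i ∈ Set.Ici (0 : ℝ)) ha hb hab
    exact h1.trans_lt (key _ _ j (ht.2 i j hij) (hu.2 i j hij))

lemma rapidRegion_nonempty [Finite ι] (c : ℕ) : (rapidRegion ι c).Nonempty := by
  have := Fintype.ofFinite ι
  let e := (Fintype.orderIsoFinOfCardEq ι rfl).symm
  -- Towers work: the `c`th power multiplies the exponent by `c`, while one step in the order
  -- multiplies it by at least `c + 2`.
  refine ⟨fun i => (((c + 2) ^ (c + 2) ^ (e i : ℕ) : ℕ) : ℝ), fun i => ?_, fun i j hij => ?_⟩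
  · have h1 : c + 2 ≤ (c + 2) ^ (c + 2) ^ (e i : ℕ) :=
      Nat.le_self_pow (pow_ne_zero _ (by omega)) _
    beta_reduce
    exact_mod_cast (by omega : c < (c + 2) ^ (c + 2) ^ (e i : ℕ))
  · have h1 : (e i : ℕ) + 1 ≤ e j := e.lt_iff_lt.2 hij
    have h2 : (c + 2) ^ (e i : ℕ) * c < (c + 2) ^ (e j : ℕ) :=
      calc (c + 2) ^ (e i : ℕ) * c < (c + 2) ^ (e i : ℕ) * (c + 2) :=
            Nat.mul_lt_mul_of_pos_left (by omega) (pow_pos (by omega) _)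
        _ = (c + 2) ^ ((e i : ℕ) + 1) := (pow_succ _ _).symm
        _ ≤ _ := Nat.pow_le_pow_right (by omega) h1
    have h3 : ((c + 2) ^ (c + 2) ^ (e i : ℕ)) ^ c < (c + 2) ^ (c + 2) ^ (e j : ℕ) := by
      rw [← pow_mul]
      exact Nat.pow_lt_pow_right (by omega) h2
    beta_reduce
    exact_mod_cast h3

lemma comp_mem_rapidRegion {c : ℕ} {t : ι → ℝ} (ht : t ∈ rapidRegion ι c) {f : κ → ι}
    (hf : StrictMono f) : t ∘ f ∈ rapidRegion κ c :=
  ⟨fun i => ht.1 (f i), fun _ _ hij => ht.2 _ _ (hf hij)⟩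

/-! ### Growth of polynomials on rapid families -/

lemma exists_norm_eval_le {N : ℕ} (g : MvPolynomial (Fin N) ℂ) : ∃ C : ℕ, ∀ (s : Fin N → ℝ) (M : ℝ),
    1 ≤ M → (∀ i, |s i| ≤ M) → ‖MvPolynomial.eval (fun i => (s i : ℂ)) g‖ ≤ C * M ^ C := by
  induction g using MvPolynomial.induction_on with
  | C a =>
    refine ⟨⌈‖a‖⌉₊, fun s M hM _ => ?_⟩
    rw [MvPolynomial.eval_C]
    exact (Nat.le_ceil _).trans (le_mul_of_one_le_right (Nat.cast_nonneg _) (one_le_pow₀ hM))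
  | add g h hg hh =>
    obtain ⟨C, hC⟩ := hg
    obtain ⟨D, hD⟩ := hh
    refine ⟨C + D, fun s M hM hs => ?_⟩
    rw [map_add, Nat.cast_add, add_mul]
    refine (norm_add_le _ _).trans (add_le_add ((hC s M hM hs).trans ?_) ((hD s M hM hs).trans ?_))
    · exact mul_le_mul_of_nonneg_left (pow_le_pow_right₀ hM (by omega)) (Nat.cast_nonneg _)
    · exact mul_le_mul_of_nonneg_left (pow_le_pow_right₀ hM (by omega)) (Nat.cast_nonneg _)
  | mul_X g i hg =>
    obtain ⟨C, hC⟩ := hg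
    refine ⟨C + 1, fun s M hM hs => ?_⟩
    have hM0 : 0 ≤ M := zero_le_one.trans hM
    rw [map_mul, norm_mul, MvPolynomial.eval_X, Complex.norm_real, Real.norm_eq_abs, pow_succ,
      ← mul_assoc]
    refine mul_le_mul ((hC s M hM hs).trans ?_) (hs i) (abs_nonneg _) (by positivity)
    push_cast
    nlinarith [pow_nonneg hM0 C]

lemma exists_sum_norm_eval_le {N : ℕ} (g : ℕ → MvPolynomial (Fin N) ℂ) (d : ℕ) :
    ∃ C : ℕ, ∀ (s : Fin N → ℝ) (M : ℝ), 1 ≤ M → (∀ i, |s i| ≤ M) →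
      ∑ k ∈ Finset.range d, ‖MvPolynomial.eval (fun i => (s i : ℂ)) (g k)‖ ≤ C * M ^ C := by
  choose C hC using fun k => exists_norm_eval_le (g k)
  refine ⟨∑ k ∈ Finset.range d, C k, fun s M hM hs => ?_⟩
  rw [Nat.cast_sum, Finset.sum_mul]
  refine Finset.sum_le_sum fun k hk => (hC k s M hM hs).trans ?_
  exact mul_le_mul_of_nonneg_left
    (pow_le_pow_right₀ hM (Finset.single_le_sum (fun _ _ => Nat.zero_le _) hk)) (Nat.cast_nonneg _)

/-- A nonzero polynomial is bounded below on the rapidly decreasing families. -/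
lemma exists_one_le_norm_eval (N : ℕ) (f : MvPolynomial (Fin N) ℂ) (hf : f ≠ 0) :
    ∃ c K : ℕ, ∀ t : Fin N → ℝ, (∀ i, (c : ℝ) < t i) → (∀ i j, i < j → t j ^ c < t i) →
      1 ≤ K * ‖MvPolynomial.eval (fun i => (t i : ℂ)) f‖ := by
  induction N with
  | zero =>
    obtain ⟨a, rfl⟩ : ∃ a, f = MvPolynomial.C a := ⟨_, MvPolynomial.eq_C_of_isEmpty f⟩
    have ha : 0 < ‖a‖ := norm_pos_iff.2 fun h => hf (by rw [h, map_zero])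
    refine ⟨0, ⌈‖a‖⁻¹⌉₊, fun t _ _ => ?_⟩
    rw [MvPolynomial.eval_C, ← inv_mul_cancel₀ ha.ne']
    exact mul_le_mul_of_nonneg_right (Nat.le_ceil _) ha.le
  | succ N ih =>
    -- Families decrease here, so variable `0` is the largest, and `f` is a polynomial in it over
    -- the others. The induction needs a lower bound for the leading coefficient, not merely its
    -- nonvanishing.
    set P := MvPolynomial.finSuccEquiv ℂ N f with hP
    have hP0 : P ≠ 0 := fun h => hf ((MvPolynomial.finSuccEquiv ℂ N).injective (by rw [← hP, h, map_zero]))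
    obtain ⟨c, K, hcK⟩ := ih P.leadingCoeff (Polynomial.leadingCoeff_ne_zero.2 hP0)
    set d := P.natDegree with hd
    obtain ⟨C, hC⟩ := exists_sum_norm_eval_le P.coeff d
    -- From `M ≥ R` it follows that `2 * K * (C * M ^ C) ≤ M ^ (C + 1)`, so the lower coefficients
    -- are small against the largest variable.
    set R : ℕ := 2 * K * C + 1 with hR
    have hR1 : (1 : ℝ) ≤ R := by exact_mod_cast (by omega : 1 ≤ R)
    -- The summands serve the induction hypothesis, the case with no further variable, and the
    -- inequality `t 1 ^ (C + 1) ≤ t 0`. Doubling `K` leaves half of the leading term for the lower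
    -- terms.
    refine ⟨c + R ^ (C + 1) + (C + 1), 2 * K, fun t ht1 ht2 => ?_⟩
    set e := c + R ^ (C + 1) + (C + 1) with he
    let s : Fin N → ℝ := fun i => t i.succ
    have hRe : R ≤ e := (Nat.le_self_pow (by omega : C + 1 ≠ 0) R).trans (by omega)
    have hs : ∀ i, (R : ℝ) ≤ s i := fun i =>
      (by exact_mod_cast hRe : (R : ℝ) ≤ e).trans (ht1 i.succ).le
    have hce : (c : ℝ) ≤ e := by exact_mod_cast (by omega : c ≤ e)
    have hlead := hcK s (fun i => hce.trans_lt (ht1 i.succ)) fun i j hij =>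
      (pow_le_pow_right₀ (hR1.trans (hs j)) (by omega : c ≤ e)).trans_lt
        (ht2 i.succ j.succ (Fin.succ_lt_succ_iff.2 hij))
    -- `M` is the second largest variable, or `R` if there is none.
    obtain ⟨M, hRM, hsM, hMy⟩ : ∃ M : ℝ, R ≤ M ∧ (∀ i, |s i| ≤ M) ∧ M ^ (C + 1) ≤ t 0 := by
      rcases N with _ | N
      · refine ⟨R, le_rfl, fun i => i.elim0, le_trans ?_ (ht1 0).le⟩
        exact_mod_cast (by omega : R ^ (C + 1) ≤ e)
      · refine ⟨s 0, hs 0, fun i => ?_, ?_⟩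
        · rw [abs_of_nonneg ((zero_le_one.trans hR1).trans (hs i))]
          rcases eq_or_ne i 0 with rfl | hi
          · exact le_rfl
          · refine le_trans ?_ (ht2 (Fin.succ 0) i.succ
              (Fin.succ_lt_succ_iff.2 (Fin.pos_of_ne_zero hi))).le
            exact le_self_pow₀ (hR1.trans (hs i)) (by omega)
        · exact (pow_le_pow_right₀ (hR1.trans (hs 0)) (by omega)).trans
            (ht2 0 (Fin.succ 0) (Fin.succ_pos 0)).le
    have hM1 : 1 ≤ M := hR1.trans hRM
    have hsum := hC s M hM1 hsM
    set S := ∑ k ∈ Finset.range d, ‖MvPolynomial.eval (fun i => (s i : ℂ)) (P.coeff k)‖ with hS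
    set y := t 0 with hy
    have hy1 : 1 ≤ y := (one_le_pow₀ hM1).trans hMy
    have hSy : 2 * K * S ≤ y := by
      have h1 : 2 * (K : ℝ) * S ≤ 2 * K * (C * M ^ C) :=
        mul_le_mul_of_nonneg_left hsum (by positivity)
      have h2 : (2 * (K : ℝ) * C) * M ^ C ≤ M * M ^ C := by
        refine mul_le_mul_of_nonneg_right (le_trans ?_ hRM) (by positivity)
        rw [hR]
        push_cast
        linarith
      rw [pow_succ'] at hMy
      linarith
    have heval : MvPolynomial.eval (fun i => (t i : ℂ)) f = ∑ k ∈ Finset.range (d + 1),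
        MvPolynomial.eval (fun i => (s i : ℂ)) (P.coeff k) * (y : ℂ) ^ k := by
      have h1 : (fun i => (t i : ℂ)) = Fin.cons (y : ℂ) (fun i => (s i : ℂ)) := by
        funext i
        refine Fin.cases rfl (fun j => rfl) i
      rw [h1, MvPolynomial.eval_eq_eval_mv_eval', Polynomial.eval_map, Polynomial.eval₂_eq_sum_range]
    set Q := ‖MvPolynomial.eval (fun i => (t i : ℂ)) f‖ with hQ
    set A := ‖MvPolynomial.eval (fun i => (s i : ℂ)) P.leadingCoeff‖ with hA
    have hQ1 : A * y ^ d ≤ Q + ∑ k ∈ Finset.range d,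
        ‖MvPolynomial.eval (fun i => (s i : ℂ)) (P.coeff k)‖ * y ^ k := by
      have h1 : ∀ k, ‖MvPolynomial.eval (fun i => (s i : ℂ)) (P.coeff k)‖ * y ^ k =
          ‖MvPolynomial.eval (fun i => (s i : ℂ)) (P.coeff k) * (y : ℂ) ^ k‖ := fun k => by
        rw [norm_mul, norm_pow, Complex.norm_real, Real.norm_of_nonneg (zero_le_one.trans hy1)]
      rw [Finset.sum_range_succ] at heval
      have h2 := eq_sub_of_add_eq' heval.symm
      simp only [h1]
      rw [hA, Polynomial.leadingCoeff, ← hd, h1 d, h2]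
      exact (norm_sub_le _ _).trans (add_le_add le_rfl (norm_sum_le _ _))
    have hQ2 : (∑ k ∈ Finset.range d,
        ‖MvPolynomial.eval (fun i => (s i : ℂ)) (P.coeff k)‖ * y ^ k) * y ≤ S * y ^ d := by
      rw [Finset.sum_mul, hS, Finset.sum_mul]
      refine Finset.sum_le_sum fun k hk => ?_
      rw [mul_assoc, ← pow_succ]
      exact mul_le_mul_of_nonneg_left (pow_le_pow_right₀ hy1 (Finset.mem_range.1 hk)) (norm_nonneg _)
    have hyd : 1 ≤ y ^ d := one_le_pow₀ hy1
    have h1 : A * y ^ d * y ≤ Q * y + S * y ^ d := by nlinarith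
    have h2 : y ^ d * y ≤ K * A * (y ^ d * y) :=
      le_mul_of_one_le_left (by positivity) hlead
    have h3 : 2 * K * S * y ^ d ≤ y * y ^ d := mul_le_mul_of_nonneg_right hSy (by positivity)
    have h4 : 2 * K * (A * y ^ d * y) ≤ 2 * K * (Q * y + S * y ^ d) :=
      mul_le_mul_of_nonneg_left h1 (by positivity)
    have h5 : y ≤ y ^ d * y := le_mul_of_one_le_left (by positivity) hyd
    -- Combined, `2 * y ^ (d + 1) ≤ 2 * K * Q * y + y ^ (d + 1)`, and `y ≤ y ^ (d + 1)`.
    have h6 : 1 * y ≤ (2 * K * Q) * y := by nlinarith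
    have h7 := le_of_mul_le_mul_right h6 (by positivity)
    push_cast
    exact h7

/-- A nonzero polynomial does not vanish on sufficiently rapidly increasing families. -/
lemma exists_eval_ne_zero [Finite ι] (f : MvPolynomial ι ℂ) (hf : f ≠ 0) :
    ∃ c : ℕ, ∀ t ∈ rapidRegion ι c, MvPolynomial.eval (fun i => (t i : ℂ)) f ≠ 0 := by
  have := Fintype.ofFinite ι
  let e : Fin (Fintype.card ι) ≃o ι := Fintype.orderIsoFinOfCardEq ι rfl
  -- Reversal of the order turns increasing families into decreasing ones.
  let g : Fin (Fintype.card ι) ≃ ι := Fin.revPerm.trans e.toEquiv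
  obtain ⟨c, K, h⟩ := exists_one_le_norm_eval _ (MvPolynomial.rename g.symm f)
    fun h0 => hf (MvPolynomial.rename_injective _ g.symm.injective (by rw [h0, map_zero]))
  refine ⟨c, fun t ht h0 => ?_⟩
  have h1 := h (fun i => t (g i)) (fun i => ht.1 _)
    (fun i j hij => ht.2 _ _ (e.lt_iff_lt.2 (Fin.rev_lt_rev.2 hij)))
  have h2 : (fun i => ((t (g i) : ℝ) : ℂ)) ∘ g.symm = fun i => (t i : ℂ) := by
    funext i
    simp
  rw [MvPolynomial.eval_rename, h2, h0, norm_zero, mul_zero] at h1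
  exact absurd h1 (by norm_num)

end RapidRegion

/-! # Base regions of constructible open subsets -/

section RapidTuples

variable {p m n : ℕ}

/-- The tuple of vectors with given real coordinates. -/
def realTuple (t : Fin (n + 1) ×ₗ Fin p → ℝ) : Fin (n + 1) × Fin p → ℂ := fun a => (t (toLex a) : ℂ)

lemma continuous_realTuple : Continuous (realTuple (p := p) (n := n)) := by
  unfold realTuple
  fun_prop

/-- The generic tuples whose orbits belong to a subset of the generic Grassmannian. -/
def tuplesOver (U : Set (genericGrassmannian p n).carrier) : Set (Fin (n + 1) × Fin p → ℂ) :=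
  {v | ∃ h : v ∈ genericTuples p n, Quotient.mk (orbitSetoid p n) ⟨v, h⟩ ∈ U}

/-- The morphism that sends a generic tuple to its orbit. -/
def orbitMorphism (U : Set (genericGrassmannian p n).carrier) :
    (affineSpace (Fin (n + 1) × Fin p)).sub (tuplesOver U) ⟶ (genericGrassmannian p n).sub U :=
  codRestrict (codRestrict ((affineSpace _).incl (tuplesOver U)) (genericTuples p n)
    (fun v => v.2.1) ≫ quotMk _ (orbitSetoid p n)) U fun v => v.2.2

lemma continuous_orbitMorphism (U : Set (genericGrassmannian p n).carrier) :
    Continuous (X := tuplesOver U) (Y := ((genericGrassmannian p n).sub U).An)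
      (orbitMorphism U).toFun :=
  (continuous_an (orbitMorphism U)).comp (continuous_toAn (tuplesOver U))

/-- The preimage of `U` among the tuples contains a nonempty principal open set of affine space, and
its polynomial is nonzero on sufficiently rapid families. -/
lemma exists_rapidRegion_subset (hp : p ≤ n + 1) {U : Set (genericGrassmannian p n).carrier}
    (hU : IsOpen U) (hne : U.Nonempty) :
    ∃ c, ∀ t ∈ rapidRegion (Fin (n + 1) ×ₗ Fin p) c, realTuple t ∈ tuplesOver U := by
  obtain ⟨q, hq⟩ := hne
  obtain ⟨v, rfl⟩ := Quotient.exists_rep q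
  obtain ⟨V, hV, hVU⟩ := isOpen_induced_iff.1
    (hU.preimage (quotMk (genericTupleSpace p n) (orbitSetoid p n)).continuous)
  have hmem : ∀ w : (genericTupleSpace p n).carrier,
      w.1 ∈ V ↔ Quotient.mk (orbitSetoid p n) w ∈ U := fun w =>
    iff_of_eq (congrArg (fun s => w ∈ s) hVU)
  obtain ⟨_, ⟨f, rfl⟩, hvf, hfV⟩ := (isTopologicalBasis_affinePoint _).exists_subset_of_mem_open
    ((hmem v).2 hq) hV
  let d : MvPolynomial (Fin (n + 1) × Fin p) ℂ := (normalForms p n hp).den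
  -- The factor `d`, a product of minors, keeps the tuples generic.
  let g : MvPolynomial (Fin (n + 1) × Fin p) ℂ := f * d
  have hg : ∀ w, MvPolynomial.eval w g ≠ 0 ↔
      MvPolynomial.eval w f ≠ 0 ∧ MvPolynomial.eval w d ≠ 0 := fun w => by
    rw [map_mul, mul_ne_zero_iff]
  have hgv := (hg v.1).2 ⟨hvf, (mem_genericTuples_iff hp v.1).1 v.2⟩
  have hg0 : MvPolynomial.rename toLex g ≠ 0 := fun h0 => hgv (by
    rw [MvPolynomial.rename_injective _ toLex.injective (h0.trans (map_zero _).symm), map_zero])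
  obtain ⟨c, hc⟩ := exists_eval_ne_zero _ hg0
  refine ⟨c, fun t ht => ?_⟩
  have h1 := hc t ht
  rw [MvPolynomial.eval_rename] at h1
  obtain ⟨h2, h3⟩ := (hg (realTuple t)).1 h1
  have h4 := (mem_genericTuples_iff hp (realTuple t)).2 h3
  exact ⟨h4, (hmem ⟨realTuple t, h4⟩).1 (hfV h2)⟩

/-- Selection of vectors, on the indices of coordinates. -/
def selectIndex (p : ℕ) (f : Fin (m + 1) ↪o Fin (n + 1)) (a : Fin (m + 1) ×ₗ Fin p) :
    Fin (n + 1) ×ₗ Fin p := toLex (f (ofLex a).1, (ofLex a).2)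

/-- Because the lexicographic order compares vector indices first, selection of vectors preserves
rapidity with the same `c`. -/
lemma strictMono_selectIndex (f : Fin (m + 1) ↪o Fin (n + 1)) : StrictMono (selectIndex p f) := by
  intro a b hab
  rcases Prod.Lex.lt_iff.1 hab with h | ⟨h1, h2⟩
  · exact Prod.Lex.lt_iff.2 (Or.inl (f.lt_iff_lt.2 h))
  · exact Prod.Lex.lt_iff.2 (Or.inr ⟨congrArg f h1, h2⟩)

end RapidTuples

/-! ### Base regions compatible with faces and inclusions -/

namespace ConstructibleOpen

variable {p : ℕ}

instance : Finite (TruncatedDelta p (2 * p)) := by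
  refine Finite.of_injective (β := Fin (2 * p + 1))
    (fun a => ⟨a.obj.len, Nat.lt_succ_of_le a.property.2⟩) fun a b h => ?_
  exact ObjectProperty.FullSubcategory.ext (SemiSimplexCategory.ext (congrArg Fin.val h))

/-- All the faces of tuples as rapidly increasing as `c` belong to the constructible open subset. -/
def IsAdmissible (U : ConstructibleOpen p) (b : TruncatedDelta p (2 * p)) (c : ℕ) : Prop :=
  ∀ a, Nonempty (a ⟶ b) → ∀ t ∈ rapidRegion (Fin (a.obj.len + 1) ×ₗ Fin p) c,
    realTuple t ∈ tuplesOver (U.carrier a)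

/-- The region of sufficiently rapidly increasing real tuples in a term of a constructible open
subset. -/
def baseRegion (U : ConstructibleOpen p) (b : TruncatedDelta p (2 * p)) :
    Set (Fin (b.obj.len + 1) ×ₗ Fin p → ℝ) :=
  {t | ∃ c, U.IsAdmissible b c ∧ t ∈ rapidRegion _ c}

variable (U : ConstructibleOpen p) {a b : TruncatedDelta p (2 * p)}

lemma realTuple_mem {t : Fin (b.obj.len + 1) ×ₗ Fin p → ℝ} (ht : t ∈ U.baseRegion b) :
    realTuple t ∈ tuplesOver (U.carrier b) := by
  obtain ⟨c, hc, htc⟩ := ht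
  exact hc b ⟨𝟙 b⟩ t htc

/-- Of two admissible regions one contains the other, so two points always lie in a common convex
one. -/
lemma convex_baseRegion : Convex ℝ (U.baseRegion b) := by
  rintro t ⟨c, hc, ht⟩ u ⟨d, hd, hu⟩ r s hr hs hrs
  rcases le_total c d with h | h
  · exact ⟨c, hc, convex_rapidRegion c ht (rapidRegion_antitone h hu) hr hs hrs⟩
  · exact ⟨d, hd, convex_rapidRegion d (rapidRegion_antitone h ht) hu hr hs hrs⟩

lemma baseRegion_nonempty (h : (U.carrier b).Nonempty) : (U.baseRegion b).Nonempty := by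
  have h1 : ∀ a, ∃ c, Nonempty (a ⟶ b) → ∀ t ∈ rapidRegion (Fin (a.obj.len + 1) ×ₗ Fin p) c,
      realTuple t ∈ tuplesOver (U.carrier a) := by
    intro a
    by_cases hab : Nonempty (a ⟶ b)
    · obtain ⟨f⟩ := hab
      obtain ⟨x, hx⟩ := h
      obtain ⟨c, hc⟩ := exists_rapidRegion_subset (a.property.1.trans (Nat.le_succ _))
        (isOpen_of_constructible (U.isOpen a)) ⟨_, U.mapsTo f hx⟩
      exact ⟨c, fun _ => hc⟩
    · exact ⟨0, fun h => absurd h hab⟩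
  choose c hc using h1
  -- There are finitely many ordinals, so one threshold serves all faces.
  obtain ⟨d, hd⟩ := Finite.exists_le c
  obtain ⟨t, ht⟩ := rapidRegion_nonempty (ι := Fin (b.obj.len + 1) ×ₗ Fin p) d
  exact ⟨t, d, fun a hab u hu => hc a hab u (rapidRegion_antitone (hd a) hu), ht⟩

/-- A face of a face is a face, so a threshold admissible for `b` is admissible for `a`. -/
lemma comp_selectIndex_mem (f : a ⟶ b) {t : Fin (b.obj.len + 1) ×ₗ Fin p → ℝ}
    (ht : t ∈ U.baseRegion b) :
    t ∘ selectIndex p (SemiSimplexCategory.homEquiv f.hom) ∈ U.baseRegion a := by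
  obtain ⟨c, hc, htc⟩ := ht
  exact ⟨c, fun a' ⟨g⟩ => hc a' ⟨g ≫ f⟩, comp_mem_rapidRegion htc (strictMono_selectIndex _)⟩

/-- Selection of vectors, on base regions. -/
def selectRegion (f : a ⟶ b) : C(U.baseRegion b, U.baseRegion a) where
  toFun t := ⟨_, U.comp_selectIndex_mem f t.2⟩
  continuous_toFun := by
    refine Continuous.subtype_mk ?_ _
    exact continuous_pi fun i => (continuous_apply (selectIndex p _ i)).comp continuous_subtype_val

/-- A threshold admissible for `V` is admissible for `U`. The union over all admissible thresholds
is what makes the region monotone. -/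
lemma baseRegion_mono {V U : ConstructibleOpen p} (h : V ≤ U) (b : TruncatedDelta p (2 * p)) :
    V.baseRegion b ⊆ U.baseRegion b := by
  rintro t ⟨c, hc, ht⟩
  refine ⟨c, fun a hab u hu => ?_, ht⟩
  obtain ⟨h1, h2⟩ := hc a hab u hu
  exact ⟨h1, h a h2⟩

/-- A term of a constructible open subset as a manifold with a base region. -/
def basedManifold (b : TruncatedDelta p (2 * p)) : BasedManifold where
  base := U.manifold b
  region := U.baseRegion b
  incl := ⟨fun t => (orbitMorphism (U.carrier b)).toFun ⟨realTuple t.1, U.realTuple_mem t.2⟩,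
    (continuous_orbitMorphism _).comp
      ((continuous_realTuple.comp continuous_subtype_val).subtype_mk _)⟩
  simplyConnected h := by
    have := U.convex_baseRegion.contractibleSpace (Set.nonempty_coe_sort.1 h)
    infer_instance
  locallyPathConnected := U.convex_baseRegion.locallyPathConnectedSpace
  nonempty h := Set.nonempty_coe_sort.2 (U.baseRegion_nonempty (h.elim fun x => ⟨x.1, x.2⟩))
  pathConnected h := pathConnectedSpace_grassmannian (b.property.1.trans (Nat.le_succ _))
    (isOpen_of_constructible (U.isOpen b)) h
  locallyPathConnected_base := locallyPathConnectedSpace_grassmannian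
    (b.property.1.trans (Nat.le_succ _)) (isOpen_of_constructible (U.isOpen b))
  nbhd := exists_simplyConnected_grassmannian (b.property.1.trans (Nat.le_succ _))
    (isOpen_of_constructible (U.isOpen b))

/-- A constructible open subset as a truncated simplicial manifold with base regions. -/
def basedSimplicialManifold : TruncatedSimplicialObject p (2 * p) BasedManifold where
  obj a := U.basedManifold a.unop
  map f := ⟨U.simplicialManifold.map f, U.selectRegion f.unop, fun _ => rfl⟩
  map_id a := BasedManifold.Hom.ext (U.simplicialManifold.map_id a) rfl
  map_comp f g := BasedManifold.Hom.ext (U.simplicialManifold.map_comp f g)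
    (ContinuousMap.ext fun t => Subtype.ext (congrArg (fun h => t.1 ∘ selectIndex p h)
      (SemiSimplexCategory.homEquiv_comp g.unop.hom f.unop.hom)))

end ConstructibleOpen

/-- The functor from the ordered set of constructible open subsets to truncated simplicial
manifolds with base regions. -/
def basedConstructibleOpens (p : ℕ) :
    ConstructibleOpen p ⥤ TruncatedSimplicialObject p (2 * p) BasedManifold where
  obj U := U.basedSimplicialManifold
  map h :=
    { app a := ⟨(ConstructibleOpen.inclusion h.le).app a,
        ⟨Set.inclusion (ConstructibleOpen.baseRegion_mono h.le a.unop), continuous_inclusion _⟩,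
        fun _ => rfl⟩
      naturality _ _ _ := rfl }
  map_id _ := rfl
  map_comp _ _ := rfl

theorem theorem7p2 (p : ℕ) (hp : 0 < p) :
    ∃ L : ConstructibleOpen p ⥤ TruncatedSimplicialObject p (2 * p) UniversalCovering,
      L ⋙ (Functor.whiskeringRight _ _ _).obj UniversalCovering.forget = constructibleOpens p :=
  -- The covering functor keeps the base and the base part of each morphism, so forgetting the
  -- coverings gives back the original functor by definition.
  ⟨basedConstructibleOpens p ⋙
    (Functor.whiskeringRight _ _ _).obj BasedManifold.universalCovering, rfl⟩
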